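/- Let the pentagrid be a tessellation $\{5,4\}$ of the hyperbolic plane $\mathbb{H}^2$, i.e. the tessellation generated from a regular right-angled pentagon by repeatedly reflecting tiles in their sides. A quarter of the pentagrid with head $P$ and vertex $S$ is the intersection of the two closed half-planes that contain the tile $P$ and are bounded by the lines supporting two consecutive sides of $P$, where $S$ is the common vertex of these two sides. Let $(F_n)_{n\in\mathbb{N}}$ be a sequence of quarters of the pentagrid such that $F_n\subseteq F_{n+1}$ for all $n$ and the sequence is not eventually constant (in particular, any sequence with $F_n\subsetneq F_{n+1}$ for all $n$ is allowed), and let $S_n$ be the vertex of $F_n$. Then there is a unique end $\alpha$ of $\mathbb{H}^2$ (a point of the boundary circle of the Poincaré disc) such that $S_n$ converges to $\alpha$ in the closed Poincaré disc as $n\to\infty$. -/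

import Mathlib

open Filter Topology
open scoped Complex.UnitDisc ComplexConjugate

/-! The hyperbolic plane is the Poincaré disc `𝔻`, the open unit disc of `ℂ`. Its ends (points at
infinity) are the points of the unit circle, and convergence to an end is convergence in the closed
disc, that is, in `ℂ`. -/

namespace Pentagrid

theorem norm_moebius_lt_one (p z : ℂ) (hp : ‖p‖ < 1) (hz : ‖z‖ < 1) :
    ‖(z - p) / (1 - conj p * z)‖ < 1 := by
  have h1 : ‖conj p * z‖ < 1 := by
    rw [norm_mul, RCLike.norm_conj]
    nlinarith [norm_nonneg p, norm_nonneg z]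
  have h2 : 1 - conj p * z ≠ 0 := by
    intro h
    have h3 : conj p * z = 1 := (sub_eq_zero.mp h).symm
    rw [h3, norm_one] at h1
    exact lt_irrefl _ h1
  have h4 : 0 < ‖1 - conj p * z‖ := norm_pos_iff.mpr h2
  rw [norm_div, div_lt_one h4]
  have hp2 : Complex.normSq p < 1 := by
    rw [Complex.normSq_eq_norm_sq]; nlinarith [norm_nonneg p]
  have hz2 : Complex.normSq z < 1 := by
    rw [Complex.normSq_eq_norm_sq]; nlinarith [norm_nonneg z]
  have h5 : ‖z - p‖ ^ 2 < ‖1 - conj p * z‖ ^ 2 := by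
    rw [← Complex.normSq_eq_norm_sq, ← Complex.normSq_eq_norm_sq]
    simp only [Complex.normSq_apply, Complex.sub_re, Complex.sub_im, Complex.mul_re,
      Complex.mul_im, Complex.conj_re, Complex.conj_im, Complex.one_re, Complex.one_im] at *
    nlinarith [mul_pos (sub_pos.mpr hp2) (sub_pos.mpr hz2)]
  exact lt_of_pow_lt_pow_left₀ 2 h4.le h5

/-- The hyperbolic isometry `z ↦ (z - p) / (1 - p̄ z)` of the disc, which moves `p` to the centre.
Geodesics through `p` become diameters, and angles at `p` become Euclidean angles. -/
noncomputable def moebius (p z : 𝔻) : 𝔻 :=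
  Complex.UnitDisc.mk (((z : ℂ) - p) / (1 - conj (p : ℂ) * z))
    (norm_moebius_lt_one p z p.norm_lt_one z.norm_lt_one)

/-- The hyperbolic distance (curvature `-1`). -/
noncomputable def hdist (z w : 𝔻) : ℝ :=
  2 * Real.arsinh (‖(z : ℂ) - w‖ / √((1 - ‖(z : ℂ)‖ ^ 2) * (1 - ‖(w : ℂ)‖ ^ 2)))

/-- The angle at `q` between the geodesic rays from `q` through `p` and from `q` through `r`
(for `p ≠ q` and `r ≠ q`). -/
noncomputable def angle (p q r : 𝔻) : ℝ :=
  InnerProductGeometry.angle (moebius q p : ℂ) (moebius q r : ℂ)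

/-- For `p ≠ q`: zero exactly when `z` lies on the hyperbolic line through `p` and `q`, and
otherwise positive or negative according to the side of this line on which `z` lies. -/
noncomputable def side (p q z : 𝔻) : ℝ :=
  (conj (moebius p q : ℂ) * (moebius p z : ℂ)).im

/-- The closed half-plane which is bounded by the line through `p` and `q` and contains `r`
(for `p ≠ q` and `r` not on the line). -/
def halfPlane (p q r : 𝔻) : Set 𝔻 :=
  {z | 0 ≤ side p q r * side p q z}

theorem norm_mirror_lt_one (u z : ℂ) (hz : ‖z‖ < 1) : ‖u / conj u * conj z‖ < 1 := by
  rw [norm_mul, norm_div, RCLike.norm_conj, RCLike.norm_conj]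
  have h := div_self_le_one ‖u‖
  nlinarith [norm_nonneg z]

/-- The hyperbolic reflection in the line through `p` and `q` (for `p ≠ q`): move `p` to the
centre, reflect in the diameter through the image `u` of `q`, and move back. -/
noncomputable def reflect (p q z : 𝔻) : 𝔻 :=
  moebius (-p) (Complex.UnitDisc.mk
    ((moebius p q : ℂ) / conj (moebius p q : ℂ) * conj (moebius p z : ℂ))
    (norm_mirror_lt_one _ _ (moebius p z).norm_lt_one))

/-- `v 0, …, v 4` are, in cyclic order, the vertices of a regular pentagon with right angles.
Indices are modulo `5`, and side `i` joins `v i` to `v (i + 1)`. -/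
structure IsRegularRightPentagon (v : Fin 5 → 𝔻) : Prop where
  /-- For every side, the three other vertices lie strictly on the same side of its line. -/
  convex : ∀ i j k : Fin 5, j ≠ i → j ≠ i + 1 → k ≠ i → k ≠ i + 1 →
    0 < side (v i) (v (i + 1)) (v j) * side (v i) (v (i + 1)) (v k)
  equal_sides : ∀ i j : Fin 5, hdist (v i) (v (i + 1)) = hdist (v j) (v (j + 1))
  right_angles : ∀ i : Fin 5, angle (v (i - 1)) (v i) (v (i + 1)) = Real.pi / 2

/-- The tiles (given by their vertices in cyclic order) of the tessellation `{5,4}` generated by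
the pentagon `v`: they are obtained from `v` by repeated reflection of tiles in their sides. -/
inductive IsTile (v : Fin 5 → 𝔻) : (Fin 5 → 𝔻) → Prop
  | base : IsTile v v
  | step (w : Fin 5 → 𝔻) (i : Fin 5) (hw : IsTile v w) :
      IsTile v (fun j => reflect (w i) (w (i + 1)) (w j))

/-- The half-plane bounded by the line which supports side `i` of the pentagon `w` and containing
the pentagon; `w (i + 3)` is the vertex opposite to that side. -/
def sideHalfPlane (w : Fin 5 → 𝔻) (i : Fin 5) : Set 𝔻 :=
  halfPlane (w i) (w (i + 1)) (w (i + 3))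

/-- `F` is a quarter with vertex `S` of the pentagrid generated by `v`: for some tile `w`, its head,
`F` is the intersection of the two half-planes which contain the head and whose border lines
support the two consecutive sides of the head that meet at `S`. -/
def IsQuarter (v : Fin 5 → 𝔻) (S : 𝔻) (F : Set 𝔻) : Prop :=
  ∃ (w : Fin 5 → 𝔻) (i : Fin 5), IsTile v w ∧ S = w i ∧
    F = sideHalfPlane w (i - 1) ∩ sideHalfPlane w i

end Pentagrid

/-! In the hyperboloid model a line is a Lorentz unit normal, a half-plane is a sign condition, and
a quarter is a right-angled sector given by two orthogonal normals.

Local finiteness is arithmetic. The Gram matrix of the five inward normals of the pentagon forces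
the golden ratio φ, and three of the normals span the others over ℤ[φ]
(`IsNormals.eq_golden_combination`). Reflections preserve the ℤ[φ]-combinations of norm `1`. The
conjugate form is positive definite, so only finitely many of them have bounded time coordinate
(`finite_goldenUnits_bounded`).

The geometry is that a sector inside a larger one cannot contain the larger one's vertex
(`IsSector.eq_of_vertex_mem`). Hence for `n ≥ m` either `S n = S m` or `S n` lies strictly behind a
border line of `F m`. If no line is a border infinitely often, both borders leave every compact set.
If some line is, every `F n` stays on one side of it, so from some point on all keep it as a border
(`IsSector.border_eq_of_subset`); the other border then escapes, since a repetition would freeze the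
sequence.

A line with normal `x` far from the centre is a Euclidean circle of small radius `1 / |x.1|`, so the
vertices form a Cauchy sequence with limit on the unit circle
(`existsUnique_tendsto_of_behind_lines`). -/

namespace Pentagrid

/-! ### The Lorentz form and its reflections -/

/-- The Lorentz form on `ℝ × ℂ`, with `ℝ` as time axis. -/
noncomputable def lor (x y : ℝ × ℂ) : ℝ := x.2.re * y.2.re + x.2.im * y.2.im - x.1 * y.1

theorem vec_ext {x y : ℝ × ℂ} (h1 : x.1 = y.1) (h2 : x.2.re = y.2.re) (h3 : x.2.im = y.2.im) :
    x = y :=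
  Prod.ext h1 (Complex.ext h2 h3)

theorem lor_comm (x y : ℝ × ℂ) : lor x y = lor y x := by
  simp only [lor]; ring

theorem lor_add_left (x y z : ℝ × ℂ) : lor (x + y) z = lor x z + lor y z := by
  simp only [lor, Prod.fst_add, Prod.snd_add, Complex.add_re, Complex.add_im]; ring

theorem lor_add_right (x y z : ℝ × ℂ) : lor x (y + z) = lor x y + lor x z := by
  simp only [lor, Prod.fst_add, Prod.snd_add, Complex.add_re, Complex.add_im]; ring

theorem lor_sub_left (x y z : ℝ × ℂ) : lor (x - y) z = lor x z - lor y z := by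
  simp only [lor, Prod.fst_sub, Prod.snd_sub, Complex.sub_re, Complex.sub_im]; ring

theorem lor_sub_right (x y z : ℝ × ℂ) : lor x (y - z) = lor x y - lor x z := by
  simp only [lor, Prod.fst_sub, Prod.snd_sub, Complex.sub_re, Complex.sub_im]; ring

theorem lor_smul_left (a : ℝ) (x y : ℝ × ℂ) : lor (a • x) y = a * lor x y := by
  simp only [lor, Prod.smul_fst, Prod.smul_snd, Complex.smul_re, Complex.smul_im, smul_eq_mul]
  ring

theorem lor_smul_right (a : ℝ) (x y : ℝ × ℂ) : lor x (a • y) = a * lor x y := by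
  simp only [lor, Prod.smul_fst, Prod.smul_snd, Complex.smul_re, Complex.smul_im, smul_eq_mul]
  ring

theorem lor_neg_left (x y : ℝ × ℂ) : lor (-x) y = -lor x y := by
  simp only [lor, Prod.fst_neg, Prod.snd_neg, Complex.neg_re, Complex.neg_im]; ring

theorem lor_neg_right (x y : ℝ × ℂ) : lor x (-y) = -lor x y := by
  simp only [lor, Prod.fst_neg, Prod.snd_neg, Complex.neg_re, Complex.neg_im]; ring

/-- The Lorentz reflection in the plane orthogonal to the unit vector `e`. -/
noncomputable def refl (e x : ℝ × ℂ) : ℝ × ℂ := x - (2 * lor e x) • e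

theorem lor_refl_refl {e : ℝ × ℂ} (he : lor e e = 1) (x y : ℝ × ℂ) :
    lor (refl e x) (refl e y) = lor x y := by
  simp only [refl, lor_sub_left, lor_sub_right, lor_smul_left, lor_smul_right, he, lor_comm x e]
  ring

theorem refl_neg (e x : ℝ × ℂ) : refl (-e) x = refl e x := by
  simp [refl, lor_neg_left]

/-! ### From the disc to the hyperboloid -/

theorem one_sub_normSq_pos (z : 𝔻) : 0 < 1 - Complex.normSq z := sub_pos.mpr z.normSq_lt_one

/-- The point of the hyperboloid which corresponds to the point `z` of the Poincaré disc. -/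
noncomputable def hyp (z : 𝔻) : ℝ × ℂ :=
  (1 - Complex.normSq z)⁻¹ • ((1 + Complex.normSq z, 2 * z) : ℝ × ℂ)

theorem lor_hyp_self (z : 𝔻) : lor (hyp z) (hyp z) = -1 := by
  have h := inv_mul_cancel₀ (one_sub_normSq_pos z).ne'
  simp only [hyp, lor_smul_left, lor_smul_right]
  generalize (1 - Complex.normSq (z : ℂ))⁻¹ = k at *
  simp only [lor, Complex.normSq_apply, Complex.mul_re, Complex.mul_im, Complex.re_ofNat,
    Complex.im_ofNat] at *
  linear_combination
    (-(k * (1 - ((z : ℂ).re * (z : ℂ).re + (z : ℂ).im * (z : ℂ).im))) - 1) * h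

theorem hyp_fst_pos (z : 𝔻) : 0 < (hyp z).1 := by
  have h := one_sub_normSq_pos z
  have := Complex.normSq_nonneg (z : ℂ)
  simp only [hyp, Prod.smul_fst, smul_eq_mul]
  positivity

/-- Every vector in the open future cone is a positive multiple of a point of the hyperboloid. -/
theorem exists_smul_hyp {x : ℝ × ℂ} (hx : lor x x < 0) (hx' : 0 < x.1) :
    ∃ (a : ℝ) (z : 𝔻), 0 < a ∧ x = a • hyp z := by
  set d := √(-lor x x) with hd
  have hd0 : 0 < d := Real.sqrt_pos.mpr (by linarith)
  have hd2 : d ^ 2 = -lor x x := Real.sq_sqrt (by linarith)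
  have hn : Complex.normSq x.2 = x.1 ^ 2 - d ^ 2 := by
    rw [hd2]; simp only [lor, Complex.normSq_apply]; ring
  have hp : 0 < x.1 + d := by linarith
  -- Stereographic projection from `(-1, 0)` sends the normalised vector `x / d` to `x.2 / (x.1 +
  -- d)`.
  have hz : ‖(((x.1 + d)⁻¹ : ℝ) : ℂ) * x.2‖ < 1 := by
    rw [← sq_lt_one_iff₀ (norm_nonneg _), ← Complex.normSq_eq_norm_sq, Complex.normSq_mul, hn,
      Complex.normSq_ofReal]
    field_simp
    nlinarith
  have h1 : 1 - Complex.normSq ((((x.1 + d)⁻¹ : ℝ) : ℂ) * x.2) = 2 * d / (x.1 + d) := by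
    rw [Complex.normSq_mul, hn, Complex.normSq_ofReal]
    field_simp
    ring
  have h2 : 1 + Complex.normSq ((((x.1 + d)⁻¹ : ℝ) : ℂ) * x.2) = 2 * x.1 / (x.1 + d) := by
    rw [Complex.normSq_mul, hn, Complex.normSq_ofReal]
    field_simp
    ring
  refine ⟨d, Complex.UnitDisc.mk _ hz, hd0, ?_⟩
  simp only [hyp, Complex.UnitDisc.coe_mk, h1, h2, smul_smul]
  ext1
  · simp only [Prod.smul_fst, smul_eq_mul]
    field_simp
  · have hdC : (d : ℂ) ≠ 0 := by exact_mod_cast hd0.ne'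
    have hpC : (x.1 : ℂ) + d ≠ 0 := by exact_mod_cast hp.ne'
    simp only [Prod.smul_snd, Complex.real_smul]
    push_cast
    field_simp

theorem hyp_injective : Function.Injective hyp := by
  intro z w h
  have h1 := congrArg Prod.fst h
  have h2 := congrArg Prod.snd h
  have hz := one_sub_normSq_pos z
  have hw := one_sub_normSq_pos w
  simp only [hyp, Prod.smul_fst, Prod.smul_snd, smul_eq_mul] at h1 h2
  have h3 : Complex.normSq z = Complex.normSq w := by
    field_simp at h1
    linarith
  rw [h3] at h2
  have h4 := smul_right_injective ℂ (inv_ne_zero hw.ne') h2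
  exact Complex.UnitDisc.coe_injective (mul_left_cancel₀ two_ne_zero h4)

/-! ### Möbius maps as Lorentz transformations -/

/-- The Lorentz transformation which corresponds to `moebius p`. -/
noncomputable def boost (p : 𝔻) (x : ℝ × ℂ) : ℝ × ℂ :=
  (1 - Complex.normSq p)⁻¹ • (((1 + Complex.normSq p) * x.1 - 2 * (conj (p : ℂ) * x.2).re,
    x.2 + (p : ℂ) ^ 2 * conj x.2 - 2 * x.1 * p) : ℝ × ℂ)

/-- The adjoint of a boost is the opposite boost; as this is also its inverse, boosts are
isometries. -/
theorem lor_boost_left (p : 𝔻) (x y : ℝ × ℂ) : lor (boost p x) y = lor x (boost (-p) y) := by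
  simp only [boost, lor_smul_left, lor_smul_right, Complex.UnitDisc.coe_neg, Complex.normSq_neg]
  congr 1
  simp only [lor, Complex.normSq_apply, Complex.mul_re, Complex.mul_im, Complex.conj_re,
    Complex.conj_im, Complex.add_re, Complex.add_im, Complex.sub_re, Complex.sub_im, pow_two,
    Complex.ofReal_re, Complex.ofReal_im, Complex.neg_re, Complex.neg_im, Complex.re_ofNat,
    Complex.im_ofNat]
  ring

theorem boost_neg_boost (p : 𝔻) (x : ℝ × ℂ) : boost (-p) (boost p x) = x := by
  have h := inv_mul_cancel₀ (one_sub_normSq_pos p).ne'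
  simp only [boost, Complex.UnitDisc.coe_neg, Complex.normSq_neg]
  generalize (1 - Complex.normSq (p : ℂ))⁻¹ = k at *
  refine vec_ext ?_ ?_ ?_
  all_goals
    simp only [Complex.normSq_apply] at h
    simp only [Complex.normSq_apply,
      Prod.smul_fst, Prod.smul_snd, smul_eq_mul, Complex.smul_re, Complex.smul_im,
      Complex.mul_re, Complex.mul_im, Complex.conj_re,
      Complex.conj_im, Complex.add_re, Complex.add_im, Complex.sub_re, Complex.sub_im, pow_two,
      Complex.ofReal_re, Complex.ofReal_im, Complex.neg_re, Complex.neg_im, Complex.re_ofNat,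
      Complex.im_ofNat]
    generalize (p : ℂ).re = a at *
    generalize (p : ℂ).im = b at *
  · linear_combination (k * (1 - (a * a + b * b)) + 1) * x.1 * h
  · linear_combination (k * (1 - (a * a + b * b)) + 1) * x.2.re * h
  · linear_combination (k * (1 - (a * a + b * b)) + 1) * x.2.im * h

theorem boost_boost_neg (p : 𝔻) (x : ℝ × ℂ) : boost p (boost (-p) x) = x := by
  simpa using boost_neg_boost (-p) x

theorem lor_boost_boost (p : 𝔻) (x y : ℝ × ℂ) : lor (boost p x) (boost p y) = lor x y := by
  rw [lor_boost_left, boost_neg_boost]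

theorem boost_sub (p : 𝔻) (x y : ℝ × ℂ) : boost p (x - y) = boost p x - boost p y := by
  refine vec_ext ?_ ?_ ?_
  all_goals
    simp only [boost, Prod.smul_fst, Prod.smul_snd, smul_eq_mul, Complex.smul_re, Complex.smul_im,
      Prod.fst_sub, Prod.snd_sub, map_sub,
      Complex.mul_re, Complex.mul_im, Complex.conj_re, Complex.ofReal_sub,
      Complex.conj_im, Complex.add_re, Complex.add_im, Complex.sub_re, Complex.sub_im, pow_two,
      Complex.ofReal_re, Complex.ofReal_im, Complex.re_ofNat, Complex.im_ofNat]
    ring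

theorem boost_smul (p : 𝔻) (a : ℝ) (x : ℝ × ℂ) : boost p (a • x) = a • boost p x := by
  refine vec_ext ?_ ?_ ?_
  all_goals
    simp only [boost, Prod.smul_fst, Prod.smul_snd, smul_eq_mul, Complex.smul_re, Complex.smul_im,
      Complex.mul_re, Complex.mul_im, Complex.conj_re, Complex.ofReal_mul,
      Complex.conj_im, Complex.add_re, Complex.add_im, Complex.sub_re, Complex.sub_im, pow_two,
      Complex.ofReal_re, Complex.ofReal_im, Complex.re_ofNat, Complex.im_ofNat]
    ring

theorem boost_refl (p : 𝔻) (e x : ℝ × ℂ) :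
    boost p (refl e x) = refl (boost p e) (boost p x) := by
  simp only [refl, boost_sub, boost_smul, lor_boost_boost]

theorem one_sub_conj_mul_ne_zero (p z : 𝔻) : 1 - conj (p : ℂ) * z ≠ 0 := by
  intro h
  have h1 : ‖conj (p : ℂ) * z‖ < 1 := by
    rw [norm_mul, RCLike.norm_conj]
    nlinarith [norm_nonneg (p : ℂ), norm_nonneg (z : ℂ), p.norm_lt_one, z.norm_lt_one]
  rw [← sub_eq_zero.mp h, norm_one] at h1
  exact lt_irrefl _ h1

theorem coe_moebius (p z : 𝔻) : (moebius p z : ℂ) = (z - p) / (1 - conj (p : ℂ) * z) := rfl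

/-- This equivariance allows every question about a point `p` to be settled with `p` at the centre.
Once the three inverses are made atoms, polynomial identities remain. -/
theorem hyp_moebius (p z : 𝔻) : hyp (moebius p z) = boost p (hyp z) := by
  have hd := one_sub_conj_mul_ne_zero p z
  have hD : 0 < Complex.normSq (1 - conj (p : ℂ) * z) := Complex.normSq_pos.mpr hd
  have hp := one_sub_normSq_pos p
  have hz := one_sub_normSq_pos z
  have h1 : 1 - Complex.normSq (moebius p z) = (1 - Complex.normSq p) * (1 - Complex.normSq z) /
      Complex.normSq (1 - conj (p : ℂ) * z) := by
    rw [coe_moebius, Complex.normSq_div, eq_div_iff hD.ne', sub_mul, div_mul_cancel₀ _ hD.ne']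
    simp only [Complex.normSq_apply, Complex.mul_re, Complex.mul_im, Complex.conj_re,
      Complex.conj_im, Complex.sub_re, Complex.sub_im, Complex.one_re, Complex.one_im]
    ring
  have h2 : 1 + Complex.normSq (moebius p z) = ((1 + Complex.normSq p) * (1 + Complex.normSq z)
      - 4 * (conj (p : ℂ) * z).re) / Complex.normSq (1 - conj (p : ℂ) * z) := by
    rw [coe_moebius, Complex.normSq_div, eq_div_iff hD.ne', add_mul, div_mul_cancel₀ _ hD.ne']
    simp only [Complex.normSq_apply, Complex.mul_re, Complex.mul_im, Complex.conj_re,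
      Complex.conj_im, Complex.sub_re, Complex.sub_im, Complex.one_re, Complex.one_im]
    ring
  have h3 : (moebius p z : ℂ) = ((Complex.normSq (1 - conj (p : ℂ) * z))⁻¹ : ℝ) •
      (((z : ℂ) - p) * (1 - p * conj (z : ℂ))) := by
    rw [coe_moebius, div_eq_mul_inv, Complex.inv_def]
    simp only [map_sub, map_mul, map_one, Complex.conj_conj, Complex.real_smul]
    ring
  have hk := inv_mul_cancel₀ hp.ne'
  have hl := inv_mul_cancel₀ hz.ne'
  have hm := inv_mul_cancel₀ hD.ne'
  have h4 : ((1 - Complex.normSq p) * (1 - Complex.normSq z) /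
      Complex.normSq (1 - conj (p : ℂ) * z))⁻¹ = (1 - Complex.normSq (p : ℂ))⁻¹ *
        (1 - Complex.normSq (z : ℂ))⁻¹ * Complex.normSq (1 - conj (p : ℂ) * z) := by
    field_simp
  rw [hyp, h1, h2, h3, h4, boost, hyp, div_eq_mul_inv]
  generalize (1 - Complex.normSq (p : ℂ))⁻¹ = k at *
  generalize (1 - Complex.normSq (z : ℂ))⁻¹ = l at *
  generalize (Complex.normSq (1 - conj (p : ℂ) * z))⁻¹ = m at *
  generalize Complex.normSq (1 - conj (p : ℂ) * z) = d at *
  refine vec_ext ?_ ?_ ?_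
  all_goals
    simp only [Prod.smul_fst, Prod.smul_snd, smul_eq_mul,
      Complex.smul_re, Complex.smul_im, Complex.mul_re, Complex.mul_im, Complex.conj_re,
      Complex.conj_im, Complex.re_ofNat, Complex.im_ofNat, Complex.add_re, Complex.add_im,
      Complex.sub_re, Complex.sub_im, pow_two, Complex.ofReal_re, Complex.ofReal_im,
      Complex.one_re, Complex.one_im, Complex.normSq_apply]
    generalize (p : ℂ).re = a at *
    generalize (p : ℂ).im = b at *
    generalize (z : ℂ).re = x at *
    generalize (z : ℂ).im = y at *
  · linear_combination k * l * ((1 + (a * a + b * b)) * (1 + (x * x + y * y))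
      - 4 * (a * x + b * y)) * hm
  · linear_combination 2 * k * l * ((x - a) * (1 - (a * x + b * y)) - (y - b) * (a * y - b * x)) * hm
  · linear_combination 2 * k * l * ((x - a) * (a * y - b * x) + (y - b) * (1 - (a * x + b * y))) * hm

theorem refl_zero_left (c : ℂ) (hc : Complex.normSq c = 1) (x : ℝ × ℂ) :
    refl (0, c) x = (x.1, -c ^ 2 * conj x.2) := by
  rw [Complex.normSq_apply] at hc
  refine vec_ext ?_ ?_ ?_
  all_goals
    simp only [refl, lor, Prod.fst_sub, Prod.snd_sub, Prod.smul_fst, Prod.smul_snd, smul_eq_mul,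
      Complex.smul_re, Complex.smul_im, Complex.mul_re, Complex.mul_im, Complex.conj_re,
      Complex.conj_im, Complex.sub_re, Complex.sub_im, pow_two, Complex.neg_re, Complex.neg_im]
  · ring
  · linear_combination -x.2.re * hc
  · linear_combination -x.2.im * hc

theorem moebius_self (p : 𝔻) : moebius p p = 0 := by
  rw [← Complex.UnitDisc.coe_eq_zero, coe_moebius]
  simp

theorem moebius_ne_zero {p q : 𝔻} (h : p ≠ q) : (moebius p q : ℂ) ≠ 0 := by
  rw [coe_moebius]
  refine div_ne_zero ?_ (one_sub_conj_mul_ne_zero p q)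
  rw [sub_ne_zero]
  exact fun h' => h (Complex.UnitDisc.coe_injective h'.symm)

theorem hyp_zero : hyp 0 = (1, 0) := by
  simp [hyp]

theorem lor_boost_hyp_self (p : 𝔻) (x : ℝ × ℂ) : lor x (hyp p) = -(boost p x).1 := by
  rw [← lor_boost_boost p, ← hyp_moebius, moebius_self, hyp_zero]
  simp [lor]

/-! ### Lines, sides and reflections through unit normals -/

/-- The direction at the centre of the disc orthogonal to the direction of `u`. -/
noncomputable def perp (u : ℂ) : ℂ := Complex.I * u / ‖u‖

theorem normSq_perp {u : ℂ} (hu : u ≠ 0) : Complex.normSq (perp u) = 1 := by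
  have h : ‖u‖ ≠ 0 := norm_ne_zero_iff.mpr hu
  rw [perp, Complex.normSq_div, Complex.normSq_mul, Complex.normSq_I, Complex.normSq_ofReal,
    Complex.normSq_eq_norm_sq]
  field_simp

theorem perp_re (u : ℂ) : (perp u).re = -u.im / ‖u‖ := by
  rw [perp, Complex.div_ofReal_re]; simp

theorem perp_im (u : ℂ) : (perp u).im = u.re / ‖u‖ := by
  rw [perp, Complex.div_ofReal_im]; simp

/-- A unit normal vector of the line through `p` and `q`, pointing to its left. -/
noncomputable def unitNormal (p q : 𝔻) : ℝ × ℂ := boost (-p) (0, perp (moebius p q))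

theorem lor_unitNormal_self {p q : 𝔻} (h : p ≠ q) :
    lor (unitNormal p q) (unitNormal p q) = 1 := by
  rw [unitNormal, lor_boost_boost]
  simpa [lor, Complex.normSq_apply] using normSq_perp (moebius_ne_zero h)

theorem boost_unitNormal (p q : 𝔻) :
    boost p (unitNormal p q) = (0, perp (moebius p q)) := boost_boost_neg _ _

/-- Only the sign of `side` matters, so a positive factor depending on `z` is harmless. -/
theorem exists_side_eq {p q : 𝔻} (h : p ≠ q) (z : 𝔻) :
    ∃ k : ℝ, 0 < k ∧ side p q z = k * lor (unitNormal p q) (hyp z) := by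
  have hu := norm_pos_iff.mpr (moebius_ne_zero h)
  have hm := one_sub_normSq_pos (moebius p z)
  refine ⟨‖(moebius p q : ℂ)‖ * (1 - Complex.normSq (moebius p z)) / 2, by positivity, ?_⟩
  rw [← lor_boost_boost p, boost_unitNormal, ← hyp_moebius, hyp, lor_smul_right]
  simp only [lor, perp_re, perp_im, side, Complex.mul_im, Complex.mul_re, Complex.conj_re,
    Complex.conj_im, Complex.re_ofNat, Complex.im_ofNat]
  field_simp
  ring

/-- With `p` at the centre, the first condition kills the time coordinate and the second makes the
spatial part orthogonal to the direction of `q`. -/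
theorem exists_eq_smul_unitNormal {p q : 𝔻} (h : p ≠ q) {x : ℝ × ℂ} (hp : lor x (hyp p) = 0)
    (hq : lor x (hyp q) = 0) : ∃ a : ℝ, x = a • unitNormal p q := by
  have hu := norm_pos_iff.mpr (moebius_ne_zero h)
  have hm := (one_sub_normSq_pos (moebius p q)).ne'
  have h1 : (boost p x).1 = 0 := by
    rw [lor_boost_hyp_self] at hp
    linarith
  have h2 : (boost p x).2.re * (moebius p q : ℂ).re +
      (boost p x).2.im * (moebius p q : ℂ).im = 0 := by
    rw [← lor_boost_boost p, ← hyp_moebius, hyp, lor_smul_right,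
      mul_eq_zero_iff_left (inv_ne_zero hm)] at hq
    simp only [lor, h1, Complex.mul_im, Complex.mul_re, Complex.re_ofNat, Complex.im_ofNat] at hq
    linarith
  have h3 : ‖(moebius p q : ℂ)‖ ^ 2 = (moebius p q : ℂ).re * (moebius p q : ℂ).re +
      (moebius p q : ℂ).im * (moebius p q : ℂ).im := by
    rw [← Complex.normSq_apply, Complex.normSq_eq_norm_sq]
  suffices h4 : ∃ a : ℝ, boost p x = a • ((0, perp (moebius p q)) : ℝ × ℂ) by
    obtain ⟨a, ha⟩ := h4
    exact ⟨a, by rw [unitNormal, ← boost_smul, ← ha, boost_neg_boost]⟩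
  generalize (moebius p q : ℂ) = u at *
  -- The coefficient is the Euclidean inner product of the spatial part with `perp u`.
  refine ⟨((boost p x).2.im * u.re - (boost p x).2.re * u.im) / ‖u‖, ?_⟩
  refine vec_ext ?_ ?_ ?_
  · simpa using h1
  · simp only [Prod.smul_mk, Complex.smul_re, smul_eq_mul, perp_re]
    rw [← sub_eq_zero]
    field_simp
    rw [h3]
    linear_combination u.re * h2
  · simp only [Prod.smul_mk, Complex.smul_im, smul_eq_mul, perp_im]
    rw [← sub_eq_zero]
    field_simp
    rw [h3]
    linear_combination u.im * h2

theorem eq_or_eq_neg_unitNormal {p q : 𝔻} (h : p ≠ q) {e : ℝ × ℂ} (he : lor e e = 1)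
    (hp : lor e (hyp p) = 0) (hq : lor e (hyp q) = 0) :
    e = unitNormal p q ∨ e = -unitNormal p q := by
  obtain ⟨a, rfl⟩ := exists_eq_smul_unitNormal h hp hq
  rw [lor_smul_left, lor_smul_right, lor_unitNormal_self h] at he
  have : a = 1 ∨ a = -1 := by
    rw [← mul_self_eq_one_iff]; linarith
  rcases this with rfl | rfl
  · left; simp
  · right; simp

theorem lor_unitNormal_left (p q : 𝔻) : lor (unitNormal p q) (hyp p) = 0 := by
  rw [lor_boost_hyp_self, boost_unitNormal, neg_zero]

theorem lor_unitNormal_right (p q : 𝔻) : lor (unitNormal p q) (hyp q) = 0 := by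
  rw [← lor_boost_boost p, boost_unitNormal, ← hyp_moebius, hyp, lor_smul_right]
  simp only [lor, perp_re, perp_im, Complex.mul_im, Complex.mul_re, Complex.re_ofNat,
    Complex.im_ofNat]
  ring

theorem hyp_reflect {p q : 𝔻} (h : p ≠ q) (z : 𝔻) :
    hyp (reflect p q z) = refl (unitNormal p q) (hyp z) := by
  have hu := moebius_ne_zero h
  have hu' : conj (moebius p q : ℂ) ≠ 0 := (map_ne_zero _).mpr hu
  have hp : -perp (moebius p q) ^ 2 = (moebius p q : ℂ) / conj (moebius p q : ℂ) := by
    have h1 : (‖(moebius p q : ℂ)‖ : ℂ) ≠ 0 := by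
      exact_mod_cast norm_ne_zero_iff.mpr hu
    rw [perp, div_pow, mul_pow, Complex.I_sq, ← neg_div, eq_div_iff hu', div_mul_eq_mul_div,
      div_eq_iff (pow_ne_zero 2 h1)]
    linear_combination (moebius p q : ℂ) * Complex.mul_conj' (moebius p q : ℂ)
  rw [reflect, hyp_moebius, unitNormal, ← boost_neg_boost p (hyp z), ← boost_refl, ← hyp_moebius p z,
    refl_zero_left _ (normSq_perp hu), hp]
  congr 1
  have hn : Complex.normSq ((moebius p q : ℂ) / conj (moebius p q : ℂ) *
      conj (moebius p z : ℂ)) = Complex.normSq (moebius p z) := by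
    rw [Complex.normSq_mul, Complex.normSq_div, Complex.normSq_conj, Complex.normSq_conj,
      div_self (Complex.normSq_pos.mpr hu).ne', one_mul]
  simp only [hyp, Complex.UnitDisc.coe_mk, hn]
  ext1
  · rfl
  · simp only [Prod.smul_snd, Complex.real_smul, map_mul, Complex.conj_ofReal, map_ofNat]
    ring

/-! ### Angles and distances through the form -/

theorem lor_unitNormal_of_angle {p q r : 𝔻} (h : angle q p r = Real.pi / 2) :
    lor (unitNormal p q) (unitNormal p r) = 0 := by
  rw [angle, ← InnerProductGeometry.inner_eq_zero_iff_angle_eq_pi_div_two, Complex.inner] at h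
  rw [unitNormal, unitNormal, lor_boost_boost]
  simp only [lor, perp_re, perp_im, Complex.mul_re, Complex.conj_re, Complex.conj_im] at *
  rw [div_mul_div_comm, div_mul_div_comm, ← add_div, mul_zero, sub_zero]
  rw [div_eq_zero_iff]
  left
  linear_combination h

/-- This is `-cosh d` written as `-1 - 2 sinh² (d / 2)`, which matches the arsinh formula in
`hdist`. -/
theorem lor_hyp_hyp (z w : 𝔻) : lor (hyp z) (hyp w) =
    -1 - 2 * (‖(z : ℂ) - w‖ / √((1 - ‖(z : ℂ)‖ ^ 2) * (1 - ‖(w : ℂ)‖ ^ 2))) ^ 2 := by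
  have hz := one_sub_normSq_pos z
  have hw := one_sub_normSq_pos w
  rw [← Complex.normSq_eq_norm_sq, ← Complex.normSq_eq_norm_sq, div_pow,
    Real.sq_sqrt (by positivity), ← Complex.normSq_eq_norm_sq]
  simp only [hyp, lor_smul_left, lor_smul_right]
  field_simp
  simp only [lor, Complex.normSq_apply, Complex.mul_re, Complex.mul_im, Complex.re_ofNat,
    Complex.im_ofNat, Complex.sub_re, Complex.sub_im]
  ring

theorem lor_hyp_hyp_le (z w : 𝔻) : lor (hyp z) (hyp w) ≤ -1 := by
  rw [lor_hyp_hyp]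
  nlinarith [sq_nonneg (‖(z : ℂ) - w‖ / √((1 - ‖(z : ℂ)‖ ^ 2) * (1 - ‖(w : ℂ)‖ ^ 2)))]

theorem lor_hyp_hyp_eq_of_hdist_eq {z w z' w' : 𝔻} (h : hdist z w = hdist z' w') :
    lor (hyp z) (hyp w) = lor (hyp z') (hyp w') := by
  rw [lor_hyp_hyp, lor_hyp_hyp, Real.arsinh_injective (mul_left_cancel₀ two_ne_zero h)]

/-- A vector is determined by its products with an orthonormal basis. -/
theorem eq_of_orthonormal {e f s : ℝ × ℂ} (hee : lor e e = 1) (hff : lor f f = 1)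
    (hss : lor s s = -1) (hef : lor e f = 0) (hes : lor e s = 0) (hfs : lor f s = 0)
    (x : ℝ × ℂ) : x = lor e x • e + lor f x • f - lor s x • s := by
  let A : Matrix (Fin 3) (Fin 3) ℝ := !![e.2.re, e.2.im, -e.1; f.2.re, f.2.im, -f.1;
    -s.2.re, -s.2.im, s.1]
  let C : Matrix (Fin 3) (Fin 3) ℝ := !![e.2.re, f.2.re, s.2.re; e.2.im, f.2.im, s.2.im;
    e.1, f.1, s.1]
  -- The entries of `A * C` are the orthonormality relations; the reversed product `C * A = 1` is
  -- the expansion formula.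
  have h1 : A * C = 1 := by
    simp only [lor] at *
    ext i j
    fin_cases i <;> fin_cases j <;>
      simp [A, C, Matrix.mul_apply, Fin.sum_univ_three] <;> linarith
  have h2 : C * A = 1 := mul_eq_one_comm.mp h1
  have h3 : C.mulVec (A.mulVec ![x.2.re, x.2.im, x.1]) = ![x.2.re, x.2.im, x.1] := by
    rw [Matrix.mulVec_mulVec, h2, Matrix.one_mulVec]
  have h4 := congrFun h3 0
  have h5 := congrFun h3 1
  have h6 := congrFun h3 2
  simp [A, C, Matrix.mulVec, dotProduct, Fin.sum_univ_three] at h4 h5 h6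
  refine vec_ext ?_ ?_ ?_
  all_goals
    simp only [lor, Prod.fst_sub, Prod.snd_sub, Prod.fst_add, Prod.snd_add, Prod.smul_fst,
      Prod.smul_snd, smul_eq_mul, Complex.add_re, Complex.add_im, Complex.sub_re, Complex.sub_im,
      Complex.smul_re, Complex.smul_im]
    linarith

/-! ### Inward normals of a right-angled pentagon -/

/-- `e i` is the unit normal of side `i` of the right-angled pentagon `w` that points to the side
on which the pentagon lies. -/
structure IsNormals (w : Fin 5 → 𝔻) (e : Fin 5 → ℝ × ℂ) : Prop where
  unit : ∀ i, lor (e i) (e i) = 1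
  left : ∀ i, lor (e i) (hyp (w i)) = 0
  right : ∀ i, lor (e i) (hyp (w (i + 1))) = 0
  pos : ∀ i j, j ≠ i → j ≠ i + 1 → 0 < lor (e i) (hyp (w j))
  orth : ∀ i, lor (e i) (e (i + 1)) = 0

theorem IsNormals.ne {w : Fin 5 → 𝔻} {e : Fin 5 → ℝ × ℂ} (h : IsNormals w e) (i : Fin 5) :
    w i ≠ w (i + 1) := by
  intro hi
  have h1 := h.right (i + 4)
  have h2 := h.pos (i + 4) (i + 1) (by clear * - i; decide +revert) (by clear * - i; decide +revert)
  rw [show i + 4 + 1 = i by clear * - i; decide +revert, hi] at h1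
  exact h2.ne' h1

theorem IsNormals.hyp_reflect {w : Fin 5 → 𝔻} {e : Fin 5 → ℝ × ℂ} (h : IsNormals w e)
    (i : Fin 5) (z : 𝔻) : hyp (reflect (w i) (w (i + 1)) z) = refl (e i) (hyp z) := by
  rw [Pentagrid.hyp_reflect (h.ne i)]
  rcases eq_or_eq_neg_unitNormal (h.ne i) (h.unit i) (h.left i) (h.right i) with h1 | h1
  · rw [h1]
  · rw [h1, refl_neg]

theorem IsNormals.reflect {w : Fin 5 → 𝔻} {e : Fin 5 → ℝ × ℂ} (h : IsNormals w e) (i : Fin 5) :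
    IsNormals (fun j => reflect (w i) (w (i + 1)) (w j)) (fun j => refl (e i) (e j)) where
  unit j := by rw [lor_refl_refl (h.unit i), h.unit]
  left j := by rw [h.hyp_reflect, lor_refl_refl (h.unit i), h.left]
  right j := by rw [h.hyp_reflect, lor_refl_refl (h.unit i), h.right]
  pos j k h1 h2 := by rw [h.hyp_reflect, lor_refl_refl (h.unit i)]; exact h.pos j k h1 h2
  orth j := by rw [lor_refl_refl (h.unit i), h.orth]

theorem IsNormals.sideHalfPlane_eq {w : Fin 5 → 𝔻} {e : Fin 5 → ℝ × ℂ} (h : IsNormals w e)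
    (i : Fin 5) : sideHalfPlane w i = {z | 0 ≤ lor (e i) (hyp z)} := by
  ext z
  have h3 := h.pos i (i + 3) (by clear * - i; decide +revert) (by clear * - i; decide +revert)
  obtain ⟨k, hk, hk'⟩ := exists_side_eq (h.ne i) z
  obtain ⟨l, hl, hl'⟩ := exists_side_eq (h.ne i) (w (i + 3))
  simp only [sideHalfPlane, halfPlane, Set.mem_ofPred_eq, hk', hl']
  rcases eq_or_eq_neg_unitNormal (h.ne i) (h.unit i) (h.left i) (h.right i) with h1 | h1
  · rw [← h1, mul_nonneg_iff_of_pos_left (mul_pos hl h3), mul_nonneg_iff_of_pos_left hk]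
  · rw [eq_neg_iff_add_eq_zero, add_comm, ← eq_neg_iff_add_eq_zero] at h1
    rw [h1, lor_neg_left, lor_neg_left, mul_neg, mul_neg, neg_mul_neg,
      mul_nonneg_iff_of_pos_left (mul_pos hl h3), mul_nonneg_iff_of_pos_left hk]

/-- Each normal is oriented by the opposite vertex `i + 3`, and convexity carries that sign to the
other vertices off the side. Orthogonality is insensitive to the signs chosen. -/
theorem IsRegularRightPentagon.exists_isNormals {v : Fin 5 → 𝔻} (hv : IsRegularRightPentagon v) :
    ∃ e, IsNormals v e := by
  have hne (i : Fin 5) : v i ≠ v (i + 1) := by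
    intro h
    have h1 := hv.convex i (i + 3) (i + 3) (by clear * - i; decide +revert) (by clear * - i; decide +revert)
      (by clear * - i; decide +revert) (by clear * - i; decide +revert)
    rw [← h] at h1
    simp [side, moebius_self] at h1
  have hprod (i j k : Fin 5) (h1 : j ≠ i) (h2 : j ≠ i + 1) (h3 : k ≠ i) (h4 : k ≠ i + 1) :
      0 < lor (unitNormal (v i) (v (i + 1))) (hyp (v j)) *
        lor (unitNormal (v i) (v (i + 1))) (hyp (v k)) := by
    have h := hv.convex i j k h1 h2 h3 h4
    obtain ⟨a, ha, ha'⟩ := exists_side_eq (hne i) (v j)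
    obtain ⟨b, hb, hb'⟩ := exists_side_eq (hne i) (v k)
    rw [ha', hb', mul_mul_mul_comm] at h
    exact (mul_pos_iff_of_pos_left (mul_pos ha hb)).mp h
  have hex (i : Fin 5) : ∃ x : ℝ × ℂ, lor x x = 1 ∧ lor x (hyp (v i)) = 0 ∧
      lor x (hyp (v (i + 1))) = 0 ∧ ∀ j, j ≠ i → j ≠ i + 1 → 0 < lor x (hyp (v j)) := by
    have h3 : i + 3 ≠ i := by clear * - i; decide +revert
    have h3' : i + 3 ≠ i + 1 := by clear * - i; decide +revert
    have h0 : lor (unitNormal (v i) (v (i + 1))) (hyp (v (i + 3))) ≠ 0 := by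
      intro h
      have := hprod i (i + 3) (i + 3) h3 h3' h3 h3'
      rw [h, mul_zero] at this
      exact lt_irrefl _ this
    rcases lt_or_gt_of_ne h0 with h | h
    · refine ⟨-unitNormal (v i) (v (i + 1)), ?_, ?_, ?_, fun j h1 h2 => ?_⟩
      · rw [lor_neg_left, lor_neg_right, neg_neg, lor_unitNormal_self (hne i)]
      · rw [lor_neg_left, lor_unitNormal_left, neg_zero]
      · rw [lor_neg_left, lor_unitNormal_right, neg_zero]
      · have := hprod i j (i + 3) h1 h2 h3 h3'
        rw [lor_neg_left]
        exact neg_pos.mpr (neg_of_mul_pos_left this h.le)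
    · refine ⟨unitNormal (v i) (v (i + 1)), lor_unitNormal_self (hne i), lor_unitNormal_left _ _,
        lor_unitNormal_right _ _, fun j h1 h2 => ?_⟩
      exact pos_of_mul_pos_left (hprod i j (i + 3) h1 h2 h3 h3') h.le
  choose e he1 he2 he3 he4 using hex
  refine ⟨e, he1, he2, he3, he4, fun i => ?_⟩
  have hi : i + 1 + 1 ≠ i := by clear * - i; decide +revert
  have ha := hv.right_angles (i + 1)
  rw [add_sub_cancel_right] at ha
  have h := lor_unitNormal_of_angle ha
  rcases eq_or_eq_neg_unitNormal (hne i).symm (he1 i) (he3 i) (he2 i) with h1 | h1 <;>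
  rcases eq_or_eq_neg_unitNormal (hne (i + 1)) (he1 _) (he2 _) (he3 _) with h2 | h2 <;>
  simp [h1, h2, lor_neg_left, lor_neg_right, h]

/-! ### The golden ratio in the Gram matrix -/

/-- In a polygon with right angles, the normals of the two neighbours of a side have the same
product as the endpoints of the side. -/
theorem lor_normals_eq_lor_endpoints {e f g s t : ℝ × ℂ} (hee : lor e e = 1) (hff : lor f f = 1)
    (hgg : lor g g = 1) (hss : lor s s = -1) (htt : lor t t = -1) (hef : lor e f = 0)
    (hfg : lor f g = 0) (hes : lor e s = 0) (hfs : lor f s = 0) (hft : lor f t = 0)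
    (hgt : lor g t = 0) (het : 0 < lor e t) (hgs : 0 < lor g s) (hst : lor s t < 0) :
    lor e g = lor s t := by
  have ht := eq_of_orthonormal hee hff hss hef hes hfs t
  have hg := eq_of_orthonormal hee hff hss hef hes hfs g
  -- Both `t` and `g` lie in the plane of `e` and `s`. Their norms and `g ⊥ t` determine `lor e g`
  -- up to sign; the positivity assumptions fix the sign.
  rw [hft, zero_smul, add_zero] at ht
  rw [hfg, zero_smul, add_zero, lor_comm s g] at hg
  have h1 : lor e t ^ 2 - lor s t ^ 2 = -1 := by
    nth_rw 1 [ht] at htt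
    rw [lor_sub_left, lor_smul_left, lor_smul_left] at htt
    linarith
  have h2 : lor e g ^ 2 - lor g s ^ 2 = 1 := by
    nth_rw 1 [hg] at hgg
    rw [lor_sub_left, lor_smul_left, lor_smul_left, lor_comm s g] at hgg
    linarith
  have h3 : lor e g * lor e t - lor g s * lor s t = 0 := by
    nth_rw 1 [hg] at hgt
    rw [lor_sub_left, lor_smul_left, lor_smul_left] at hgt
    linarith
  have h4 : lor e g < 0 := by
    by_contra! h
    have := mul_nonneg h het.le
    have := mul_neg_of_pos_of_neg hgs hst
    linarith
  have h5 : lor e g ^ 2 = lor s t ^ 2 := by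
    have h6 : (lor e g * lor e t) ^ 2 = (lor g s * lor s t) ^ 2 := by
      rw [sub_eq_zero.mp h3]
    linear_combination -h6 + lor e g ^ 2 * h1 + lor s t ^ 2 * h2
  rcases sq_eq_sq_iff_eq_or_eq_neg.mp h5 with h6 | h6
  · exact h6
  · linarith

/-- Expanding `g` and `h` in the basis `e, f, s` leaves three equations in `c`, `lor s g`, `lor s
h`. Eliminating the last two gives `c⁴ - 3c² + 1 = (c² - c - 1)(c² + c - 1) = 0`, and `c ≥ 1`
excludes the second factor. -/
theorem eq_goldenRatio_of_gram {e f g h s : ℝ × ℂ} {c : ℝ} (hc : 1 ≤ c) (hee : lor e e = 1)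
    (hff : lor f f = 1) (hgg : lor g g = 1) (hhh : lor h h = 1) (hss : lor s s = -1)
    (hef : lor e f = 0) (hfg : lor f g = 0) (hgh : lor g h = 0) (heg : lor e g = -c)
    (hfh : lor f h = -c) (heh : lor e h = -c) (hes : lor e s = 0) (hfs : lor f s = 0) :
    c = Real.goldenRatio ∧ h = e - c • f + c • g := by
  have hg' := eq_of_orthonormal hee hff hss hef hes hfs g
  have hh' := eq_of_orthonormal hee hff hss hef hes hfs h
  rw [heg, hfg, zero_smul, add_zero] at hg'
  rw [heh, hfh] at hh'
  have h1 : c ^ 2 - lor s g ^ 2 = 1 := by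
    nth_rw 1 [hg'] at hgg
    rw [lor_sub_left, lor_smul_left, lor_smul_left, heg] at hgg
    linarith
  have h2 : 2 * c ^ 2 - lor s h ^ 2 = 1 := by
    nth_rw 1 [hh'] at hhh
    rw [lor_sub_left, lor_add_left, lor_smul_left, lor_smul_left, lor_smul_left, heh, hfh] at hhh
    linarith
  have h3 : c ^ 2 - lor s g * lor s h = 0 := by
    nth_rw 1 [hg'] at hgh
    rw [lor_sub_left, lor_smul_left, lor_smul_left, heh] at hgh
    linarith
  have h4 : (c ^ 2 - c - 1) * (c ^ 2 + c - 1) = 0 := by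
    linear_combination -(lor s g * lor s h + c ^ 2) * h3 + h1 * (2 * c ^ 2 - 1) +
      lor s g ^ 2 * h2
  have h5 : c ^ 2 = c + 1 := by
    rcases mul_eq_zero.mp h4 with h | h <;> nlinarith
  refine ⟨?_, ?_⟩
  · have h6 : (c - Real.goldenRatio) * (c + Real.goldenRatio - 1) = 0 := by
      linear_combination h5 - Real.goldenRatio_sq
    rcases mul_eq_zero.mp h6 with h | h
    · linarith
    · linarith [Real.one_lt_goldenRatio]
  · have h7 : lor s g ≠ 0 := by
      intro h
      rw [h] at h3
      nlinarith
    have h6 : lor s h = c * lor s g := by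
      apply mul_left_cancel₀ h7
      linear_combination c * h1 - h3 - c * h5
    rw [h6] at hh'
    generalize lor s g = b at hg' hh'
    rw [hh', hg']
    linear_combination (norm := module) h5 • e

theorem IsNormals.eq_golden_combination {v : Fin 5 → 𝔻} {e : Fin 5 → ℝ × ℂ}
    (hv : IsRegularRightPentagon v) (h : IsNormals v e) :
    lor (e 0) (e 2) = -Real.goldenRatio ∧
    e 3 = e 0 - Real.goldenRatio • e 1 + Real.goldenRatio • e 2 ∧
    e 4 = e 2 - Real.goldenRatio • e 1 + Real.goldenRatio • e 0 := by
  have hgram (i : Fin 5) : lor (e i) (e (i + 2)) = lor (hyp (v 0)) (hyp (v 1)) := by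
    have h2 : i + 1 + 1 = i + 2 := by clear * - i; decide +revert
    have h3 := lor_hyp_hyp_eq_of_hdist_eq (hv.equal_sides 0 (i + 1))
    rw [h2, show (0 : Fin 5) + 1 = 1 from rfl] at h3
    rw [h3]
    refine lor_normals_eq_lor_endpoints (h.unit i) (h.unit (i + 1)) (h.unit (i + 2))
      (lor_hyp_self _) (lor_hyp_self _) (h.orth i) ?_ (h.right i) (h.left _) ?_ (h.left _)
      (h.pos _ _ ?_ ?_) (h.pos _ _ ?_ ?_) (by linarith [lor_hyp_hyp_le (v (i + 1)) (v (i + 2))])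
    · rw [← h2]; exact h.orth _
    · rw [← h2]; exact h.right _
    all_goals
      clear * - i
      revert i
      decide
  have hc := lor_hyp_hyp_le (v 0) (v 1)
  have h1 := eq_goldenRatio_of_gram (e := e 0) (f := e 1) (g := e 2) (h := e 3) (s := hyp (v 1))
    (c := -lor (hyp (v 0)) (hyp (v 1))) (by linarith) (h.unit _) (h.unit _) (h.unit _) (h.unit _)
    (lor_hyp_self _) (h.orth 0) (h.orth 1) (h.orth 2) (by rw [neg_neg]; exact hgram 0)
    (by rw [neg_neg]; exact hgram 1) (by rw [neg_neg, lor_comm]; exact hgram 3) (h.right 0)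
    (h.left 1)
  -- The same argument with the pentagon read backwards yields `e 4`.
  have h2 := eq_goldenRatio_of_gram (e := e 2) (f := e 1) (g := e 0) (h := e 4) (s := hyp (v 2))
    (c := -lor (hyp (v 0)) (hyp (v 1))) (by linarith) (h.unit _) (h.unit _) (h.unit _) (h.unit _)
    (lor_hyp_self _) (by rw [lor_comm]; exact h.orth 1) (by rw [lor_comm]; exact h.orth 0)
    (by rw [lor_comm]; exact h.orth 4) (by rw [neg_neg, lor_comm]; exact hgram 0)
    (by rw [neg_neg, lor_comm]; exact hgram 4) (by rw [neg_neg]; exact hgram 2) (h.left 2)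
    (h.right 1)
  obtain ⟨hc1, h1⟩ := h1
  rw [hc1] at h1 h2
  exact ⟨by rw [← hc1, neg_neg]; exact hgram 0, h1, h2.2⟩

/-! ### Arithmetic over ℤ[φ] and local finiteness -/

/-- The ring `ℤ[φ]`, embedded in `ℝ × ℝ` by its two real embeddings. -/
noncomputable def goldenRing : Subring (ℝ × ℝ) where
  carrier := {x | ∃ a b : ℤ, x = (a + b * Real.goldenRatio, a + b * Real.goldenConj)}
  zero_mem' := ⟨0, 0, by ext <;> simp⟩
  one_mem' := ⟨1, 0, by ext <;> simp⟩
  add_mem' := by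
    rintro _ _ ⟨a, b, rfl⟩ ⟨c, d, rfl⟩
    exact ⟨a + c, b + d, by ext <;> simp <;> ring⟩
  neg_mem' := by
    rintro _ ⟨a, b, rfl⟩
    exact ⟨-a, -b, by ext <;> simp <;> ring⟩
  mul_mem' := by
    rintro _ _ ⟨a, b, rfl⟩ ⟨c, d, rfl⟩
    refine ⟨a * c + b * d, a * d + b * c + b * d, ?_⟩
    ext
    · simp only [Prod.fst_mul]
      push_cast
      linear_combination (b * d : ℝ) * Real.goldenRatio_sq
    · simp only [Prod.snd_mul]
      push_cast
      linear_combination (b * d : ℝ) * Real.goldenConj_sq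

/-- The golden ratio together with its conjugate. -/
noncomputable def goldenPair : ℝ × ℝ := (Real.goldenRatio, Real.goldenConj)

theorem goldenPair_mem : goldenPair ∈ goldenRing := ⟨0, 1, by ext <;> simp [goldenPair]⟩

theorem finite_goldenRing_bounded (M : ℝ) :
    {x : ℝ × ℝ | x ∈ goldenRing ∧ |x.1| ≤ M ∧ |x.2| ≤ M}.Finite := by
  have hfin : (Set.Icc (-⌈3 * M⌉) ⌈3 * M⌉ ×ˢ Set.Icc (-⌈3 * M⌉) ⌈3 * M⌉ : Set (ℤ × ℤ)).Finite :=
    (Set.finite_Icc _ _).prod (Set.finite_Icc _ _)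
  refine (hfin.image fun p : ℤ × ℤ => ((p.1 + p.2 * Real.goldenRatio,
    p.1 + p.2 * Real.goldenConj) : ℝ × ℝ)).subset ?_
  rintro _ ⟨⟨a, b, rfl⟩, h1, h2⟩
  refine ⟨(a, b), ?_, rfl⟩
  simp only [abs_le] at h1 h2
  have hφ := Real.one_lt_goldenRatio
  have hφ2 := Real.goldenRatio_lt_two
  have hψ : Real.goldenConj = 1 - Real.goldenRatio := by linarith [Real.goldenRatio_add_goldenConj]
  rw [hψ] at h2
  have hM := Int.le_ceil (3 * M)
  have hM0 : 0 ≤ M := by linarith [h1.1, h1.2]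
  -- The two embeddings differ by `b * (2φ - 1)`, and `2φ - 1 > 1`.
  have hb : |(b : ℝ)| ≤ 2 * M := by
    rw [abs_le]
    constructor
    · by_contra! hb
      nlinarith
    · by_contra! hb
      nlinarith
  rw [abs_le] at hb
  have hb2 : -(2 * M) ≤ b * (Real.goldenRatio - 1) ∧ b * (Real.goldenRatio - 1) ≤ 2 * M := by
    constructor <;> nlinarith
  simp only [Set.mem_prod, Set.mem_Icc]
  refine ⟨⟨?_, ?_⟩, ?_, ?_⟩
  all_goals
    rify
    linarith [hb.1, hb.2, hb2.1, hb2.2, h1.1, h1.2, h2.1, h2.2]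

/-- The combinations of `e`, `f`, `g` with coefficients in `ℤ[φ]` that have norm `1` for the form
with Gram matrix `(1, 0, -φ; 0, 1, 0; -φ, 0, 1)` and for its conjugate. -/
def goldenUnits (e f g : ℝ × ℂ) : Set (ℝ × ℂ) :=
  {x | ∃ a ∈ goldenRing, ∃ b ∈ goldenRing, ∃ c ∈ goldenRing,
    x = a.1 • e + b.1 • f + c.1 • g ∧ a * a + b * b + c * c - 2 * goldenPair * a * c = 1}

section

variable {e f g : ℝ × ℂ}

theorem refl_mem_goldenUnits (hee : lor e e = 1) (hff : lor f f = 1) (hgg : lor g g = 1)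
    (hef : lor e f = 0) (hfg : lor f g = 0) (heg : lor e g = -Real.goldenRatio) {x y : ℝ × ℂ}
    (hx : x ∈ goldenUnits e f g) (hy : y ∈ goldenUnits e f g) :
    refl x y ∈ goldenUnits e f g := by
  obtain ⟨a, ha, b, hb, c, hc, rfl, h1⟩ := hx
  obtain ⟨a', ha', b', hb', c', hc', rfl, h2⟩ := hy
  -- `t` is the Gram form evaluated in `ℝ × ℝ`: its first entry is the Lorentz product and its
  -- second the conjugate one, so one computation preserves both norms.
  set t := a * a' + b * b' + c * c' - goldenPair * (a * c' + c * a') with ht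
  have ht1 : lor (a.1 • e + b.1 • f + c.1 • g) (a'.1 • e + b'.1 • f + c'.1 • g) = t.1 := by
    simp only [lor_add_left, lor_add_right, lor_smul_left, lor_smul_right, lor_comm f e,
      lor_comm g e, lor_comm g f, hee, hff, hgg, hef, hfg, heg]
    simp only [ht, goldenPair, Prod.fst_add, Prod.fst_sub, Prod.fst_mul]
    ring
  have htm : t ∈ goldenRing :=
    sub_mem (add_mem (add_mem (mul_mem ha ha') (mul_mem hb hb')) (mul_mem hc hc'))
      (mul_mem goldenPair_mem (add_mem (mul_mem ha hc') (mul_mem hc ha')))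
  have h2m : (2 : ℝ × ℝ) ∈ goldenRing := ofNat_mem goldenRing 2
  refine ⟨a' - 2 * t * a, sub_mem ha' (mul_mem (mul_mem h2m htm) ha),
    b' - 2 * t * b, sub_mem hb' (mul_mem (mul_mem h2m htm) hb),
    c' - 2 * t * c, sub_mem hc' (mul_mem (mul_mem h2m htm) hc), ?_, ?_⟩
  · rw [refl, ht1]
    simp only [Prod.fst_sub, Prod.fst_mul, Prod.fst_ofNat]
    module
  · linear_combination h2 + 4 * t * t * h1 - 4 * t * ht

theorem abs_lor_le (x y : ℝ × ℂ) : |lor x y| ≤ ‖x.2‖ * ‖y.2‖ + |x.1| * |y.1| := by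
  have h : lor x y = (conj x.2 * y.2).re - x.1 * y.1 := by
    simp [lor, Complex.mul_re]
  rw [h]
  refine (abs_sub _ _).trans (add_le_add ?_ (abs_mul _ _).le)
  refine (Complex.abs_re_le_norm _).trans ?_
  rw [norm_mul, RCLike.norm_conj]

theorem norm_snd_sq {x : ℝ × ℂ} (hx : lor x x = 1) : ‖x.2‖ ^ 2 = 1 + x.1 ^ 2 := by
  rw [← Complex.normSq_eq_norm_sq, Complex.normSq_apply]
  simp only [lor] at hx
  linarith

theorem lor_self_of_mem_goldenUnits (hee : lor e e = 1) (hff : lor f f = 1) (hgg : lor g g = 1)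
    (hef : lor e f = 0) (hfg : lor f g = 0) (heg : lor e g = -Real.goldenRatio) {x : ℝ × ℂ}
    (hx : x ∈ goldenUnits e f g) : lor x x = 1 := by
  obtain ⟨a, ha, b, hb, c, hc, rfl, h1⟩ := hx
  simp only [lor_add_left, lor_add_right, lor_smul_left, lor_smul_right, lor_comm f e,
      lor_comm g e, lor_comm g f, hee, hff, hgg, hef, hfg, heg]
  have h2 := congrArg Prod.fst h1
  simp only [goldenPair, Prod.fst_add, Prod.fst_sub, Prod.fst_mul, Prod.fst_one,
    Prod.fst_ofNat] at h2
  linarith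

/-- For a unit vector a bound on `x.1` bounds all of `x`, hence its products with `e, f, g` and the
first embeddings of its coefficients. The second embeddings are bounded because the conjugate form
is positive definite and equals `1`. -/
theorem finite_goldenUnits_bounded (hee : lor e e = 1) (hff : lor f f = 1) (hgg : lor g g = 1)
    (hef : lor e f = 0) (hfg : lor f g = 0) (heg : lor e g = -Real.goldenRatio) (R : ℝ) :
    {x | x ∈ goldenUnits e f g ∧ |x.1| ≤ R}.Finite := by
  obtain ⟨K, hK⟩ : ∃ K : ℝ, ∀ y ∈ ({e, f, g} : Set (ℝ × ℂ)), ‖y.2‖ + |y.1| ≤ K := by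
    refine ⟨(‖e.2‖ + |e.1|) + (‖f.2‖ + |f.1|) + (‖g.2‖ + |g.1|), ?_⟩
    have h1 : 0 ≤ ‖e.2‖ + |e.1| := by positivity
    have h2 : 0 ≤ ‖f.2‖ + |f.1| := by positivity
    have h3 : 0 ≤ ‖g.2‖ + |g.1| := by positivity
    rintro y (rfl | rfl | rfl) <;> linarith
  have hφ := Real.one_lt_goldenRatio
  have hφ2 := Real.goldenRatio_lt_two
  have hφq := Real.goldenRatio_sq
  have hψ : Real.goldenConj = 1 - Real.goldenRatio := by linarith [Real.goldenRatio_add_goldenConj]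
  set L := (1 + |R|) * K with hL
  set M := 3 * L + 3 with hM
  have hfin := finite_goldenRing_bounded M
  refine ((hfin.prod (hfin.prod hfin)).image fun p : (ℝ × ℝ) × (ℝ × ℝ) × (ℝ × ℝ) =>
    p.1.1 • e + p.2.1.1 • f + p.2.2.1 • g).subset ?_
  rintro x ⟨hx, hR⟩
  have hxx := lor_self_of_mem_goldenUnits hee hff hgg hef hfg heg hx
  obtain ⟨a, ha, b, hb, c, hc, hxe, h1⟩ := hx
  have hpair (y : ℝ × ℂ) (hy : y ∈ ({e, f, g} : Set (ℝ × ℂ))) : |lor x y| ≤ L := by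
    have h2 := hK y hy
    have h3 : ‖x.2‖ ≤ 1 + |R| := by
      have h4 : ‖x.2‖ ^ 2 ≤ (1 + |R|) ^ 2 := by
        rw [norm_snd_sq hxx, ← sq_abs x.1]
        nlinarith [abs_nonneg x.1, le_abs_self R, abs_nonneg R]
      exact le_of_sq_le_sq h4 (by positivity)
    have h5 : |x.1| ≤ 1 + |R| := by linarith [le_abs_self R]
    calc |lor x y| ≤ ‖x.2‖ * ‖y.2‖ + |x.1| * |y.1| := abs_lor_le x y
      _ ≤ (1 + |R|) * ‖y.2‖ + (1 + |R|) * |y.1| := by gcongr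
      _ = (1 + |R|) * (‖y.2‖ + |y.1|) := by ring
      _ ≤ L := mul_le_mul_of_nonneg_left h2 (by positivity)
  have he := hpair e (by simp)
  have hf := hpair f (by simp)
  have hg := hpair g (by simp)
  simp only [hxe, lor_add_left, lor_smul_left, lor_comm f e, lor_comm g e, lor_comm g f, hee, hff,
    hgg, hef, hfg, heg, abs_le] at he hf hg
  have h2 := congrArg Prod.snd h1
  simp only [goldenPair, Prod.snd_add, Prod.snd_sub, Prod.snd_mul, Prod.snd_one,
    Prod.snd_ofNat, hψ] at h2
  have hL0 : 0 ≤ L := by linarith [hf.1, hf.2]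
  have hsq : ∀ t : ℝ, t ^ 2 ≤ 9 → |t| ≤ M := by
    intro t ht
    have : |t| ≤ 3 := abs_le_of_sq_le_sq (by linarith) (by norm_num)
    linarith
  have hφ3 : Real.goldenRatio < 7 / 4 := by nlinarith
  -- As `-ψ = φ - 1` lies in `(0, 1)`, the cross term is absorbed into `(φ - 1)(a + c)²`.
  have hs1 : (1 - (Real.goldenRatio - 1)) * (a.2 ^ 2 + c.2 ^ 2) + b.2 ^ 2 ≤ 1 := by
    nlinarith [mul_nonneg (sub_pos.mpr hφ).le (sq_nonneg (a.2 + c.2))]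
  have hac : a.2 ^ 2 + c.2 ^ 2 ≤ 4 := by
    nlinarith [sq_nonneg a.2, sq_nonneg b.2, sq_nonneg c.2]
  have hb2 : b.2 ^ 2 ≤ 9 := by
    nlinarith [sq_nonneg a.2, sq_nonneg b.2, sq_nonneg c.2]
  -- Inverts the Gram block of `e` and `g`, using `1 - φ² = -φ`.
  have key (u w : ℝ) (h3 : |u - Real.goldenRatio * w| ≤ L)
      (h4 : |w - Real.goldenRatio * u| ≤ L) : |u| ≤ M := by
    have h5 : Real.goldenRatio * u = -((u - Real.goldenRatio * w) +
        Real.goldenRatio * (w - Real.goldenRatio * u)) := by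
      linear_combination -u * hφq
    have h6 : |Real.goldenRatio * u| ≤ L + Real.goldenRatio * L := by
      rw [h5, abs_neg]
      refine (abs_add_le _ _).trans (add_le_add h3 ?_)
      rw [abs_mul, abs_of_pos Real.goldenRatio_pos]
      exact mul_le_mul_of_nonneg_left h4 Real.goldenRatio_pos.le
    rw [abs_mul, abs_of_pos Real.goldenRatio_pos] at h6
    have h7 := le_mul_of_one_le_left (abs_nonneg u) hφ.le
    have h8 := mul_le_mul_of_nonneg_right hφ2.le hL0
    linarith
  refine ⟨(a, b, c), ⟨⟨ha, ?_, ?_⟩, ⟨hb, ?_, ?_⟩, hc, ?_, ?_⟩, hxe.symm⟩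
  · exact key a.1 c.1 (by rw [abs_le]; constructor <;> linarith [he.1, he.2])
      (by rw [abs_le]; constructor <;> linarith [hg.1, hg.2])
  · exact hsq _ (by nlinarith [sq_nonneg c.2])
  · rw [abs_le]; constructor <;> linarith [hf.1, hf.2]
  · exact hsq _ hb2
  · exact key c.1 a.1 (by rw [abs_le]; constructor <;> linarith [hg.1, hg.2])
      (by rw [abs_le]; constructor <;> linarith [he.1, he.2])
  · exact hsq _ (by nlinarith [sq_nonneg a.2])

end

/-- The sides of the tiles lie on lines with locally finite normals. -/
theorem IsRegularRightPentagon.exists_normals {v : Fin 5 → 𝔻} (hv : IsRegularRightPentagon v) :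
    ∃ N : Set (ℝ × ℂ), (∀ x ∈ N, lor x x = 1) ∧ (∀ R, {x | x ∈ N ∧ |x.1| ≤ R}.Finite) ∧
      ∀ w, IsTile v w → ∃ e, IsNormals w e ∧ ∀ i, e i ∈ N := by
  obtain ⟨e, he⟩ := hv.exists_isNormals
  obtain ⟨h02, h3, h4⟩ := he.eq_golden_combination hv
  have h01 : lor (e 0) (e 1) = 0 := he.orth 0
  have h12 : lor (e 1) (e 2) = 0 := he.orth 1
  have h0 := he.unit 0
  have h1 := he.unit 1
  have h2 := he.unit 2
  refine ⟨goldenUnits (e 0) (e 1) (e 2), fun x hx => ?_, fun R => ?_, fun w hw => ?_⟩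
  · exact lor_self_of_mem_goldenUnits h0 h1 h2 h01 h12 h02 hx
  · exact finite_goldenUnits_bounded h0 h1 h2 h01 h12 h02 R
  · induction hw with
    | base =>
      refine ⟨e, he, ?_⟩
      have hg := goldenPair_mem
      have ho := one_mem goldenRing
      have hz := zero_mem goldenRing
      intro i
      fin_cases i
      · exact ⟨1, ho, 0, hz, 0, hz, by simp, by ring⟩
      · exact ⟨0, hz, 1, ho, 0, hz, by simp, by ring⟩
      · exact ⟨0, hz, 0, hz, 1, ho, by simp, by ring⟩
      · exact ⟨1, ho, -goldenPair, neg_mem hg, goldenPair, hg,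
          by simp [h3, goldenPair, sub_eq_add_neg], by ring⟩
      · exact ⟨goldenPair, hg, -goldenPair, neg_mem hg, 1, ho,
          by simp only [goldenPair, Prod.fst_neg, Prod.fst_one]; refine h4.trans ?_; module,
          by ring⟩
    | step w i hw ih =>
      obtain ⟨n, hn, hnN⟩ := ih
      exact ⟨_, hn.reflect i, fun j =>
        refl_mem_goldenUnits h0 h1 h2 h01 h12 h02 (hnN i) (hnN j)⟩

/-! ### Nested right-angled sectors -/

/-- `F` is the right-angled sector with vertex `S` bounded by the lines with normals `e`, `f`. -/
structure IsSector (e f : ℝ × ℂ) (S : 𝔻) (F : Set 𝔻) : Prop where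
  left_unit : lor e e = 1
  right_unit : lor f f = 1
  orth : lor e f = 0
  left_vertex : lor e (hyp S) = 0
  right_vertex : lor f (hyp S) = 0
  eq : F = {z | 0 ≤ lor e (hyp z) ∧ 0 ≤ lor f (hyp z)}

/-- The future cone is open, so points can be perturbed linearly in any direction without returning
to the hyperboloid. -/
theorem eventually_future {y : ℝ × ℂ} (h1 : lor y y < 0) (h2 : 0 < y.1) (d : ℝ × ℂ) :
    ∀ᶠ t : ℝ in 𝓝[>] 0, lor (y + t • d) (y + t • d) < 0 ∧ 0 < (y + t • d).1 := by
  have c1 : Continuous fun t : ℝ => lor (y + t • d) (y + t • d) := by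
    simp only [lor, Prod.fst_add, Prod.snd_add, Prod.smul_fst, Prod.smul_snd, Complex.add_re,
      Complex.add_im, Complex.smul_re, Complex.smul_im]
    fun_prop
  have c2 : Continuous fun t : ℝ => (y + t • d).1 := by fun_prop
  refine Filter.Eventually.filter_mono nhdsWithin_le_nhds ?_
  exact (c1.continuousAt.eventually_lt continuousAt_const (by simpa using h1)).and
    (continuousAt_const.eventually_lt c2.continuousAt (by simpa using h2))

namespace IsSector

variable {e f e' f' g y : ℝ × ℂ} {S S' : 𝔻} {F F' : Set 𝔻}

theorem symm (h : IsSector e f S F) : IsSector f e S F where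
  left_unit := h.right_unit
  right_unit := h.left_unit
  orth := by rw [lor_comm, h.orth]
  left_vertex := h.right_vertex
  right_vertex := h.left_vertex
  eq := by rw [h.eq]; ext z; exact and_comm

theorem vertex_mem (h : IsSector e f S F) : S ∈ F := by
  rw [h.eq]
  exact ⟨h.left_vertex.ge, h.right_vertex.ge⟩

theorem subset_left (h : IsSector e f S F) : F ⊆ {z | 0 ≤ lor e (hyp z)} := by
  rw [h.eq]
  exact fun z hz => hz.1

theorem subset_right (h : IsSector e f S F) : F ⊆ {z | 0 ≤ lor f (hyp z)} := h.symm.subset_left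

/-- Half-plane inequalities are homogeneous, so an inclusion of sets in the disc extends to the
cones over them. -/
theorem nonneg_of_subset (h : IsSector e f S F) (hg : F ⊆ {z | 0 ≤ lor g (hyp z)})
    (h1 : lor y y < 0) (h2 : 0 < y.1) (he : 0 ≤ lor e y) (hf : 0 ≤ lor f y) : 0 ≤ lor g y := by
  obtain ⟨a, z, ha, rfl⟩ := exists_smul_hyp h1 h2
  rw [lor_smul_right, mul_nonneg_iff_of_pos_left ha] at *
  exact hg (by rw [h.eq]; exact ⟨he, hf⟩)

theorem lor_nonneg (h : IsSector e f S F) (hg : F ⊆ {z | 0 ≤ lor g (hyp z)})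
    (hS : lor g (hyp S) = 0) : 0 ≤ lor g e := by
  obtain ⟨t, ⟨h1, h2⟩, ht⟩ := ((eventually_future (by rw [lor_hyp_self]; norm_num)
    (hyp_fst_pos S) e).and self_mem_nhdsWithin).exists
  have ht' : 0 < t := ht
  have h3 := h.nonneg_of_subset hg h1 h2
    (by rw [lor_add_right, h.left_vertex, lor_smul_right, h.left_unit]; linarith)
    (by rw [lor_add_right, h.right_vertex, lor_smul_right, lor_comm, h.orth]; linarith)
  rw [lor_add_right, hS, lor_smul_right, zero_add] at h3
  exact nonneg_of_mul_nonneg_right h3 ht'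

/-- From `S'` one can move a little along both `e` and `-e` inside the sector; a functional that is
nonnegative there and zero at `S'` is constant in this direction. -/
theorem lor_eq_zero (h : IsSector e f S F) (hg : F ⊆ {z | 0 ≤ lor g (hyp z)})
    (hS : lor g (hyp S') = 0) (he : 0 < lor e (hyp S')) (hf : 0 ≤ lor f (hyp S')) :
    lor g e = 0 := by
  have hs : lor (hyp S') (hyp S') < 0 := by rw [lor_hyp_self]; norm_num
  have hlt : ∀ᶠ t : ℝ in 𝓝[>] 0, t < lor e (hyp S') :=
    nhdsWithin_le_nhds (eventually_lt_nhds he)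
  obtain ⟨t, ⟨⟨⟨h1, h2⟩, h3, h4⟩, h5⟩, ht⟩ := ((((eventually_future hs (hyp_fst_pos S') e).and
    (eventually_future hs (hyp_fst_pos S') (-e))).and hlt).and self_mem_nhdsWithin).exists
  have ht' : 0 < t := ht
  have h6 := h.nonneg_of_subset hg h1 h2
    (by rw [lor_add_right, lor_smul_right, h.left_unit]; linarith)
    (by rw [lor_add_right, lor_smul_right, lor_comm f e, h.orth]; linarith)
  have h7 := h.nonneg_of_subset hg h3 h4
    (by rw [lor_add_right, lor_smul_right, lor_neg_right, h.left_unit]; linarith)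
    (by rw [lor_add_right, lor_smul_right, lor_neg_right, lor_comm f e, h.orth]; linarith)
  rw [lor_add_right, hS, lor_smul_right, zero_add] at h6
  rw [lor_add_right, hS, lor_smul_right, zero_add, lor_neg_right] at h7
  have h8 := nonneg_of_mul_nonneg_right h6 ht'
  have h9 := nonneg_of_mul_nonneg_right h7 ht'
  linarith

theorem eq_combination (h : IsSector e f S F) (x : ℝ × ℂ) :
    x = lor e x • e + lor f x • f - lor (hyp S) x • hyp S :=
  eq_of_orthonormal h.left_unit h.right_unit (lor_hyp_self S) h.orth h.left_vertex
    h.right_vertex x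

/-- Otherwise both `e'` and `f'` would be orthogonal to `e`, leaving `e` a multiple of the timelike
`hyp S'`, although it has norm `1`. -/
theorem left_lor_vertex_eq_zero (h : IsSector e f S F) (h' : IsSector e' f' S' F') (hF : F ⊆ F')
    (hS : S' ∈ F) : lor e (hyp S') = 0 := by
  rw [h.eq] at hS
  by_contra hne
  have hpos := lt_of_le_of_ne hS.1 (Ne.symm hne)
  have h1 := h.lor_eq_zero (hF.trans h'.subset_left) h'.left_vertex hpos hS.2
  have h2 := h.lor_eq_zero (hF.trans h'.subset_right) h'.right_vertex hpos hS.2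
  have h3 := h'.eq_combination e
  rw [h1, h2, zero_smul, zero_smul, zero_add, zero_sub] at h3
  have h4 := h.left_unit
  nth_rw 1 [h3] at h4
  rw [lor_neg_left, lor_smul_left] at h4
  nlinarith [mul_self_nonneg (lor (hyp S') e)]

/-- The vertex of a sector is its only extreme point. -/
theorem eq_of_vertex_mem (h : IsSector e f S F) (h' : IsSector e' f' S' F') (hF : F ⊆ F')
    (hS : S' ∈ F) : S' = S ∧ F' = F := by
  have h1 := h.left_lor_vertex_eq_zero h' hF hS
  have h2 := h.symm.left_lor_vertex_eq_zero h' hF hS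
  have h3 := h.eq_combination (hyp S')
  rw [h1, h2, zero_smul, zero_smul, zero_add, zero_sub, ← neg_smul] at h3
  have h4 := lor_hyp_hyp_le S S'
  have h5 := lor_hyp_self S'
  have h6 : lor (hyp S) (hyp S') = -1 := by
    nth_rw 1 [h3] at h5
    rw [lor_smul_left] at h5
    nlinarith
  rw [h6, neg_neg, one_smul] at h3
  obtain rfl := hyp_injective h3
  refine ⟨rfl, ?_⟩
  -- With a common vertex, `e'` and `f'` are orthonormal with nonnegative coordinates in the basis
  -- `e, f`, hence equal to it up to order.
  have e1 := h.lor_nonneg (hF.trans h'.subset_left) h'.left_vertex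
  have e2 := h.symm.lor_nonneg (hF.trans h'.subset_left) h'.left_vertex
  have f1 := h.lor_nonneg (hF.trans h'.subset_right) h'.right_vertex
  have f2 := h.symm.lor_nonneg (hF.trans h'.subset_right) h'.right_vertex
  have he := h.eq_combination e'
  have hf := h.eq_combination f'
  rw [lor_comm (hyp S'), h'.left_vertex, zero_smul, sub_zero, lor_comm e, lor_comm f] at he
  rw [lor_comm (hyp S'), h'.right_vertex, zero_smul, sub_zero, lor_comm e, lor_comm f] at hf
  have hee := h'.left_unit
  have hff := h'.right_unit
  have hef := h'.orth
  generalize lor e' e = a at *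
  generalize lor e' f = b at *
  generalize lor f' e = c at *
  generalize lor f' f = d at *
  subst he hf
  simp only [lor_add_left, lor_add_right, lor_smul_left, lor_smul_right, h.left_unit,
    h.right_unit, h.orth, lor_comm f e] at hee hff hef
  have hac : a * c = 0 := by nlinarith [mul_nonneg e1 f1, mul_nonneg e2 f2]
  have hbd : b * d = 0 := by nlinarith [mul_nonneg e1 f1, mul_nonneg e2 f2]
  rcases mul_eq_zero.mp hac with rfl | rfl
  · have hb : b = 1 := by nlinarith
    subst hb
    have hd : d = 0 := by linarith
    subst hd
    have hc : c = 1 := by nlinarith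
    subst hc
    rw [h'.symm.eq, h.eq]
    simp
  · have hd : d = 1 := by nlinarith
    subst hd
    have hb : b = 0 := by linarith
    subst hb
    have ha : a = 1 := by nlinarith
    subst ha
    rw [h'.eq, h.eq]
    simp

theorem eq_left_of_vanishing (h : IsSector e f S F) (hg : F ⊆ {z | 0 ≤ lor g (hyp z)})
    (hgg : lor g g = 1) {a b : ℝ} (hab : a ≠ b) (ha : lor g (hyp S + a • f) = 0)
    (hb : lor g (hyp S + b • f) = 0) : g = e := by
  rw [lor_add_right, lor_smul_right] at ha hb
  have h1 : lor g f = 0 := by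
    have : (a - b) * lor g f = 0 := by linarith
    exact (mul_eq_zero.mp this).resolve_left (sub_ne_zero.mpr hab)
  have h2 : lor g (hyp S) = 0 := by rw [h1] at ha; linarith
  have h3 := h.lor_nonneg hg h2
  have h4 := h.eq_combination g
  rw [lor_comm f, lor_comm (hyp S), h1, h2, zero_smul, zero_smul, add_zero, sub_zero,
    lor_comm e] at h4
  have h5 : lor g e = 1 := by
    nth_rw 1 [h4] at hgg
    rw [lor_smul_left, lor_comm e] at hgg
    nlinarith
  rw [h4, h5, one_smul]

/-- If both were positive at the border point `y`, a small step along `-e` would stay in `F'` but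
cross the line of `e`. -/
theorem vanishing_of_subset (h : IsSector e f S F) (h' : IsSector e' f' S' F') (hF : F ⊆ F')
    (hF' : F' ⊆ {z | 0 ≤ lor e (hyp z)}) (h1 : lor y y < 0) (h2 : 0 < y.1) (he : lor e y = 0)
    (hf : 0 ≤ lor f y) : lor e' y = 0 ∨ lor f' y = 0 := by
  by_contra! hne
  have h3 := lt_of_le_of_ne (h.nonneg_of_subset (hF.trans h'.subset_left) h1 h2 he.ge hf)
    hne.1.symm
  have h4 := lt_of_le_of_ne (h.nonneg_of_subset (hF.trans h'.subset_right) h1 h2 he.ge hf)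
    hne.2.symm
  have hev {g : ℝ × ℂ} (hg : 0 < lor g y) : ∀ᶠ t : ℝ in 𝓝[>] 0, 0 < lor g (y + t • -e) := by
    simp only [lor_add_right, lor_smul_right]
    have hc : Continuous fun t : ℝ => lor g y + t * lor g (-e) := by fun_prop
    exact nhdsWithin_le_nhds
      (continuousAt_const.eventually_lt hc.continuousAt (by simpa using hg))
  obtain ⟨t, ⟨⟨⟨h5, h6⟩, h7⟩, h8⟩, ht⟩ := ((((eventually_future h1 h2 (-e)).and (hev h3)).and
    (hev h4)).and self_mem_nhdsWithin).exists
  have ht' : 0 < t := ht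
  have h9 := h'.nonneg_of_subset hF' h5 h6 h7.le h8.le
  rw [lor_add_right, he, lor_smul_right, lor_neg_right, h.left_unit] at h9
  linarith

/-- If a sector grows but stays on the same side of one of its border lines, then it keeps this
border line. -/
theorem border_eq_of_subset (h : IsSector e f S F) (h' : IsSector e' f' S' F') (hF : F ⊆ F')
    (hF' : F' ⊆ {z | 0 ≤ lor e (hyp z)}) : e' = e ∨ f' = e := by
  have hs : lor (hyp S) (hyp S) < 0 := by rw [lor_hyp_self]; norm_num
  obtain ⟨t, ⟨⟨h1, h2⟩, h3, h4⟩, ht⟩ := (((eventually_future hs (hyp_fst_pos S) f).and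
    (eventually_future hs (hyp_fst_pos S) ((2 : ℝ) • f))).and self_mem_nhdsWithin).exists
  have ht' : 0 < t := ht
  rw [smul_smul] at h3 h4
  have key (a : ℝ) (ha : 0 ≤ a) (h1 : lor (hyp S + a • f) (hyp S + a • f) < 0)
      (h2 : 0 < (hyp S + a • f).1) :
      lor e' (hyp S + a • f) = 0 ∨ lor f' (hyp S + a • f) = 0 := by
    refine h.vanishing_of_subset h' hF hF' h1 h2 ?_ ?_
    · rw [lor_add_right, h.left_vertex, lor_smul_right, h.orth]; ring
    · rw [lor_add_right, h.right_vertex, lor_smul_right, h.right_unit]; linarith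
  -- Pigeonhole: at each of three points of the border ray one of the two normals vanishes, so one
  -- of them vanishes at two points.
  have k0 := key 0 le_rfl (by simpa using hs) (by simpa using hyp_fst_pos S)
  have k1 := key t ht'.le h1 h2
  have k2 := key (t * 2) (by linarith) h3 h4
  have ne01 : (0 : ℝ) ≠ t := ht'.ne
  have ne02 : (0 : ℝ) ≠ t * 2 := by linarith
  have ne12 : t ≠ t * 2 := by linarith
  have fe {a b : ℝ} (hab : a ≠ b) (ha : lor e' (hyp S + a • f) = 0)
      (hb : lor e' (hyp S + b • f) = 0) : e' = e :=
    h.eq_left_of_vanishing (hF.trans h'.subset_left) h'.left_unit hab ha hb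
  have ff {a b : ℝ} (hab : a ≠ b) (ha : lor f' (hyp S + a • f) = 0)
      (hb : lor f' (hyp S + b • f) = 0) : f' = e :=
    h.eq_left_of_vanishing (hF.trans h'.subset_right) h'.right_unit hab ha hb
  rcases k0 with k0 | k0 <;> rcases k1 with k1 | k1 <;> rcases k2 with k2 | k2
  · exact .inl (fe ne01 k0 k1)
  · exact .inl (fe ne01 k0 k1)
  · exact .inl (fe ne02 k0 k2)
  · exact .inr (ff ne12 k1 k2)
  · exact .inl (fe ne12 k1 k2)
  · exact .inr (ff ne02 k0 k2)
  · exact .inr (ff ne01 k0 k1)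
  · exact .inr (ff ne01 k0 k1)

end IsSector

/-! ### Lines as Euclidean circles, and convergence to an end -/

/-- The line with normal `x` is carried by the circle with centre `x.2 / x.1` and radius `1 /
|x.1|`. -/
theorem lor_hyp_eq_circle {x : ℝ × ℂ} (hx : lor x x = 1) (h0 : x.1 ≠ 0) (z : 𝔻) :
    (1 - Complex.normSq z) * lor x (hyp z) =
      x.1 * ((1 / x.1) ^ 2 - ‖(z : ℂ) - x.2 / x.1‖ ^ 2) := by
  have h := (one_sub_normSq_pos z).ne'
  rw [← Complex.normSq_eq_norm_sq, hyp, lor_smul_right, mul_inv_cancel_left₀ h,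
    Complex.normSq_apply]
  simp only [lor, Complex.normSq_apply, Complex.mul_re, Complex.mul_im, Complex.re_ofNat,
    Complex.im_ofNat, Complex.sub_re, Complex.sub_im, Complex.div_ofReal_re,
    Complex.div_ofReal_im] at *
  field_simp
  linear_combination hx

/-- A point on a line or on the side of it that does not contain the centre (`x.1 * lor x z ≥ 0`)
lies in the Euclidean disc bounded by the circle which supports the line. -/
theorem norm_sub_center_le {x : ℝ × ℂ} (hx : lor x x = 1) (h0 : x.1 ≠ 0) {z : 𝔻}
    (hz : 0 ≤ x.1 * lor x (hyp z)) : ‖(z : ℂ) - x.2 / x.1‖ ≤ 1 / |x.1| := by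
  have h := lor_hyp_eq_circle hx h0 z
  have h1 := mul_nonneg (one_sub_normSq_pos z).le hz
  have h2 : 0 ≤ x.1 ^ 2 * ((1 / x.1) ^ 2 - ‖(z : ℂ) - x.2 / x.1‖ ^ 2) := by
    linear_combination h1 + x.1 * h
  have h3 := nonneg_of_mul_nonneg_right h2 (by positivity)
  refine le_of_sq_le_sq ?_ (by positivity)
  rw [div_pow, sq_abs, ← div_pow]
  linarith

theorem one_le_norm_center {x : ℝ × ℂ} (hx : lor x x = 1) (h0 : x.1 ≠ 0) :
    1 ≤ ‖x.2 / (x.1 : ℂ)‖ := by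
  rw [norm_div, Complex.norm_real, Real.norm_eq_abs, one_le_div (abs_pos.mpr h0)]
  apply abs_le_of_sq_le_sq _ (norm_nonneg _)
  rw [norm_snd_sq hx]
  linarith

theorem one_sub_norm_le {x : ℝ × ℂ} (hx : lor x x = 1) (h0 : x.1 ≠ 0) {z : 𝔻}
    (hz : 0 ≤ x.1 * lor x (hyp z)) : 1 - ‖(z : ℂ)‖ ≤ 1 / |x.1| := by
  have h1 := norm_sub_center_le hx h0 hz
  have h2 := one_le_norm_center hx h0
  have h3 := norm_sub_norm_le (x.2 / (x.1 : ℂ)) z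
  rw [norm_sub_rev] at h3
  linarith

/-- A sequence in the disc converges to an end if, for lines whose distance from the centre tends
to infinity, it stays behind these lines. -/
theorem existsUnique_tendsto_of_behind_lines (S : ℕ → 𝔻) (P : 𝔻) (R : ℕ → ℝ)
    (hR : Tendsto R atTop atTop) (N : ℕ)
    (h : ∀ m n, N ≤ m → m ≤ n → ∃ x : ℝ × ℂ, lor x x = 1 ∧ R m ≤ |x.1| ∧
      0 ≤ lor x (hyp P) ∧ lor x (hyp (S m)) = 0 ∧ lor x (hyp (S n)) ≤ 0) :
    ∃! α : Circle, Tendsto (fun n => (S n : ℂ)) atTop (𝓝 (α : ℂ)) := by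
  have hP : 0 < 1 - ‖(P : ℂ)‖ := sub_pos.mpr P.norm_lt_one
  -- From `M` on, the circles are too small to reach from the unit circle to `P`.
  obtain ⟨M, hM⟩ := (tendsto_atTop_atTop.mp hR) (1 / (1 - ‖(P : ℂ)‖) + 1)
  have hpos (m : ℕ) (hm : M ≤ m) : 0 < R m := by
    have h1 := hM m hm
    have : 0 < 1 / (1 - ‖(P : ℂ)‖) := by positivity
    linarith
  have key (m n : ℕ) (hm : max N M ≤ m) (hn : m ≤ n) :
      ‖(S n : ℂ) - S m‖ ≤ 2 / R m ∧ 1 - ‖(S m : ℂ)‖ ≤ 1 / R m := by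
    have hmM := (le_max_right N M).trans hm
    obtain ⟨x, hx, hRx, hxP, hxm, hxn⟩ := h m n ((le_max_left N M).trans hm) hn
    have h1 := hM m hmM
    have h2 := hpos m hmM
    have hinv : 1 / |x.1| ≤ 1 / R m := one_div_le_one_div_of_le h2 hRx
    have h0 : x.1 ≠ 0 := abs_pos.mp (h2.trans_le hRx)
    -- `P` is outside the small disc, so its side of the line is that of the centre; the points
    -- behind the line are those inside the disc.
    have hneg : x.1 < 0 := by
      by_contra! hx0
      have h3 := one_sub_norm_le hx h0 (mul_nonneg hx0 hxP)
      have h4 := (le_one_div hP (h2.trans_le hRx)).mp h3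
      linarith
    have h5 := norm_sub_center_le hx h0 (mul_nonneg_of_nonpos_of_nonpos hneg.le hxn)
    have hxm' : 0 ≤ x.1 * lor x (hyp (S m)) := by rw [hxm, mul_zero]
    have h6 := norm_sub_center_le hx h0 hxm'
    have h7 := one_sub_norm_le hx h0 hxm'
    refine ⟨?_, h7.trans hinv⟩
    calc ‖(S n : ℂ) - S m‖ ≤ ‖(S n : ℂ) - x.2 / x.1‖ + ‖x.2 / (x.1 : ℂ) - S m‖ :=
          norm_sub_le_norm_sub_add_norm_sub _ _ _
      _ ≤ 1 / R m + 1 / R m := by rw [norm_sub_rev (x.2 / (x.1 : ℂ))]; linarith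
      _ = 2 / R m := by ring
  have hlim (c : ℝ) : Tendsto (fun m => c / R m) atTop (𝓝 0) := hR.const_div_atTop c
  have hcauchy : CauchySeq fun n => (S n : ℂ) := by
    rw [Metric.cauchySeq_iff']
    intro ε hε
    obtain ⟨m, hm, hm'⟩ := (((hlim 2).eventually_lt_const hε).and
      (eventually_ge_atTop (max N M))).exists
    exact ⟨m, fun n hn => by rw [dist_eq_norm]; exact (key m n hm' hn).1.trans_lt hm⟩
  obtain ⟨a, ha⟩ := cauchySeq_tendsto_of_complete hcauchy
  have hnorm : ‖a‖ = 1 := by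
    have h1 : Tendsto (fun n => ‖(S n : ℂ)‖) atTop (𝓝 1) := by
      have h2 : Tendsto (fun m => 1 - 1 / R m) atTop (𝓝 1) := by
        simpa using (hlim 1).const_sub 1
      refine tendsto_of_tendsto_of_tendsto_of_le_of_le' h2 tendsto_const_nhds ?_
        (Eventually.of_forall fun n => (S n).norm_lt_one.le)
      filter_upwards [eventually_ge_atTop (max N M)] with m hm
      linarith [(key m m hm le_rfl).2]
    exact tendsto_nhds_unique ha.norm h1
  refine ⟨⟨a, mem_sphere_zero_iff_norm.mpr hnorm⟩, ha, fun β hβ => ?_⟩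
  exact Circle.ext (tendsto_nhds_unique hβ ha)

/-! ### The two cases for increasing sequences of quarters -/

theorem tendsto_abs_fst_of_locally_finite {N : Set (ℝ × ℂ)}
    (hN : ∀ R, {x | x ∈ N ∧ |x.1| ≤ R}.Finite) {x : ℕ → ℝ × ℂ} (hx : ∀ n, x n ∈ N)
    (hfin : ∀ y, {n | x n = y}.Finite) : Tendsto (fun n => |(x n).1|) atTop atTop := by
  rw [tendsto_atTop]
  intro R
  have h : {n | |(x n).1| ≤ R}.Finite := by
    refine ((hN R).biUnion fun y _ => hfin y).subset fun n hn => ?_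
    simp only [Set.mem_iUnion]
    exact ⟨x n, ⟨hx n, hn⟩, rfl⟩
  have h' := h.eventually_cofinite_notMem
  rw [Nat.cofinite_eq_atTop] at h'
  filter_upwards [h'] with n hn
  exact (not_le.mp hn).le

theorem IsQuarter.exists_isSector {v : Fin 5 → 𝔻} {N : Set (ℝ × ℂ)}
    (hN : ∀ w, IsTile v w → ∃ e, IsNormals w e ∧ ∀ i, e i ∈ N) {S : 𝔻} {F : Set 𝔻}
    (h : IsQuarter v S F) : ∃ e ∈ N, ∃ f ∈ N, IsSector e f S F := by
  obtain ⟨w, i, hw, rfl, rfl⟩ := h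
  obtain ⟨e, he, heN⟩ := hN w hw
  have h1 := he.right (i - 1)
  have h2 := he.orth (i - 1)
  rw [sub_add_cancel] at h1 h2
  refine ⟨e (i - 1), heN _, e i, heN _, he.unit _, he.unit _, h2, h1, he.left i, ?_⟩
  rw [he.sideHalfPlane_eq, he.sideHalfPlane_eq]
  rfl

section

variable {N : Set (ℝ × ℂ)} {F : ℕ → Set 𝔻} {S : ℕ → 𝔻} {e f : ℕ → ℝ × ℂ}

theorem existsUnique_tendsto_of_common_border (hN1 : ∀ x ∈ N, lor x x = 1)
    (hN : ∀ R, {x | x ∈ N ∧ |x.1| ≤ R}.Finite) (heN : ∀ n, e n ∈ N) (hfN : ∀ n, f n ∈ N)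
    (hsec : ∀ n, IsSector (e n) (f n) (S n) (F n)) (hF : Monotone F)
    (hnonconst : ∀ N, ∃ n, N ≤ n ∧ F (n + 1) ≠ F n) {x : ℝ × ℂ}
    (hx : ∃ᶠ n in atTop, e n = x ∨ f n = x) :
    ∃! α : Circle, Tendsto (fun n => (S n : ℂ)) atTop (𝓝 (α : ℂ)) := by
  have hborder {n : ℕ} (hn : e n = x ∨ f n = x) : ∃ g ∈ N, IsSector x g (S n) (F n) := by
    rcases hn with rfl | rfl
    · exact ⟨f n, hfN n, hsec n⟩
    · exact ⟨e n, heN n, (hsec n).symm⟩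
  -- Each `F n` is contained in a later quarter that has `x` as a border.
  have hsub (n : ℕ) : F n ⊆ {z | 0 ≤ lor x (hyp z)} := by
    obtain ⟨m, hm, hm'⟩ := frequently_atTop.mp hx n
    obtain ⟨g, -, hg⟩ := hborder hm'
    exact (hF hm).trans hg.subset_left
  obtain ⟨M, -, hM⟩ := frequently_atTop.mp hx 0
  obtain ⟨g₀, -, hg₀⟩ := hborder hM
  -- `g m` is the second border of `F m`; below `M` the value `e m` is only a filler in `N`.
  have hex (m : ℕ) : ∃ g ∈ N, M ≤ m → IsSector x g (S m) (F m) := by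
    by_cases hm : M ≤ m
    · obtain ⟨g, hgN, hg⟩ := hborder (hg₀.border_eq_of_subset (hsec m) (hF hm) (hsub m))
      exact ⟨g, hgN, fun _ => hg⟩
    · exact ⟨e m, heN m, fun h => absurd h hm⟩
  choose g hgN hg using hex
  -- A second border that recurs forever gives equal quarters arbitrarily far apart, and
  -- monotonicity makes everything between them constant.
  have hfin (y : ℝ × ℂ) : {n | g n = y}.Finite := by
    by_contra hinf
    have hinf' : ∀ k, ∃ m, k ≤ m ∧ g m = y := by
      intro k
      obtain ⟨m, hm, hkm⟩ := Set.Infinite.exists_gt hinf k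
      exact ⟨m, hkm.le, hm⟩
    obtain ⟨m, hm, hmy⟩ := hinf' M
    obtain ⟨n, hn, hne⟩ := hnonconst m
    obtain ⟨k, hk, hky⟩ := hinf' (n + 1)
    have heq : F k = F m := by
      rw [(hg k (by omega)).eq, (hg m hm).eq, hky, hmy]
    refine hne (Set.Subset.antisymm ?_ (hF n.le_succ))
    exact (hF hk).trans (heq.le.trans (hF hn))
  refine existsUnique_tendsto_of_behind_lines S (S M) (fun m => |(g m).1|)
    (tendsto_abs_fst_of_locally_finite hN hgN hfin) M fun m n hm hmn => ?_
  have hsm := hg m hm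
  have hsn := hg n (hm.trans hmn)
  refine ⟨g m, hN1 _ (hgN m), le_rfl, hsm.subset_right (hF hm hg₀.vertex_mem),
    hsm.right_vertex, ?_⟩
  -- `S n` is on the common border, so being in front of `g m` would put it in `F m` and force `S n
  -- = S m`, which lies on `g m`.
  by_contra! hpos
  have hmem : S n ∈ F m := by
    rw [hsm.eq]
    exact ⟨hsn.left_vertex.ge, hpos.le⟩
  have := (hsm.eq_of_vertex_mem hsn (hF hmn) hmem).1
  rw [this, hsm.right_vertex] at hpos
  exact lt_irrefl _ hpos

/-- Each line borders finitely many quarters, so both borders escape. A later vertex in front of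
both borders of `F m` would lie in `F m`; which border it is behind may depend on `n`. -/
theorem existsUnique_tendsto_of_no_common_border (hN1 : ∀ x ∈ N, lor x x = 1)
    (hN : ∀ R, {x | x ∈ N ∧ |x.1| ≤ R}.Finite) (heN : ∀ n, e n ∈ N) (hfN : ∀ n, f n ∈ N)
    (hsec : ∀ n, IsSector (e n) (f n) (S n) (F n)) (hF : Monotone F)
    (hx : ∀ x, ∀ᶠ n in atTop, ¬(e n = x ∨ f n = x)) :
    ∃! α : Circle, Tendsto (fun n => (S n : ℂ)) atTop (𝓝 (α : ℂ)) := by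
  have hfin (y : ℝ × ℂ) : {n | e n = y ∨ f n = y}.Finite := by
    have h := hx y
    rw [← Nat.cofinite_eq_atTop, eventually_cofinite] at h
    simpa only [not_not] using h
  have he := tendsto_abs_fst_of_locally_finite hN heN
    fun y => (hfin y).subset fun n hn => Or.inl hn
  have hf := tendsto_abs_fst_of_locally_finite hN hfN
    fun y => (hfin y).subset fun n hn => Or.inr hn
  refine existsUnique_tendsto_of_behind_lines S (S 0) (fun m => min |(e m).1| |(f m).1|)
    (tendsto_atTop.mpr fun R => by
      filter_upwards [tendsto_atTop.mp he R, tendsto_atTop.mp hf R] with n h1 h2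
      exact le_min h1 h2) 0 fun m n _ hmn => ?_
  have h0 : S 0 ∈ F m := hF m.zero_le (hsec 0).vertex_mem
  by_cases hmem : lor (e m) (hyp (S n)) ≤ 0
  · exact ⟨e m, hN1 _ (heN m), min_le_left _ _, (hsec m).subset_left h0, (hsec m).left_vertex,
      hmem⟩
  · refine ⟨f m, hN1 _ (hfN m), min_le_right _ _, (hsec m).subset_right h0,
      (hsec m).right_vertex, ?_⟩
    by_contra! hpos
    have hmem' : S n ∈ F m := by
      rw [(hsec m).eq]
      exact ⟨(not_le.mp hmem).le, hpos.le⟩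
    have := ((hsec m).eq_of_vertex_mem (hsec n) (hF hmn) hmem').1
    rw [this, (hsec m).right_vertex] at hpos
    exact lt_irrefl _ hpos

end

end Pentagrid

theorem theorem1 (v : Fin 5 → 𝔻) (hv : Pentagrid.IsRegularRightPentagon v)
    (F : ℕ → Set 𝔻) (S : ℕ → 𝔻)
    (hquarter : ∀ n, Pentagrid.IsQuarter v (S n) (F n))
    (hembedded : ∀ n, F n ⊆ F (n + 1))
    (hnonconst : ∀ N, ∃ n, N ≤ n ∧ F (n + 1) ≠ F n) :
    ∃! α : Circle, Tendsto (fun n => (S n : ℂ)) atTop (𝓝 (α : ℂ)) := by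
  obtain ⟨N, hN1, hN, hNt⟩ := hv.exists_normals
  choose e heN f hfN hsec using fun n => (hquarter n).exists_isSector hNt
  have hF : Monotone F := monotone_nat_of_le_succ hembedded
  by_cases hx : ∃ x, ∃ᶠ n in atTop, e n = x ∨ f n = x
  · obtain ⟨x, hx⟩ := hx
    exact Pentagrid.existsUnique_tendsto_of_common_border hN1 hN heN hfN hsec hF hnonconst hx
  · simp only [not_exists, not_frequently] at hx
    exact Pentagrid.existsUnique_tendsto_of_no_common_border hN1 hN heN hfN hsec hF hx
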